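/- Write $\langle z\rangle=(1+|z|^2)^{1/2}$, $\langle z,\mu\rangle=(1+|z|^2+\mu^2)^{1/2}$, $|(z,\mu)|=(|z|^2+\mu^2)^{1/2}$ for $z\in\mathbb R^m$, $\mu\in\overline{\mathbb R}_+=[0,\infty)$, and let $d,\nu\in\mathbb R$. Smoothness is always understood up to the boundary. * $S^{d}_{1,0}(\mathbb R^m)$ is the space of smooth $p:\mathbb R^m\to\mathbb C$ with $|\partial^\alpha p(z)|\le C_\alpha\langle z\rangle^{d-|\alpha|}$ for all multi-indices $\alpha$. * $\widetilde S^{d,\nu}_{1,0}(\mathbb R^m\times\overline{\mathbb R}_+)$ is the space of smooth $a:\mathbb R^m\times\overline{\mathbb R}_+\to\mathbb C$ with $|\partial_z^\alpha\partial_\mu^j a(z,\mu)|\le C_{\alpha,j}\langle z\rangle^{\nu-|\alpha|}\langle z,\mu\rangle^{d-\nu-j}$ for all $\alpha$ and $j$. * $\mathbf{\widetilde S}^{d,\nu}_{1,0}(\mathbb R^m\times\overline{\mathbb R}_+)$ is the space of those $a\in\widetilde S^{d,\nu}_{1,0}(\mathbb R^m\times\overline{\mathbb R}_+)$ for which there are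 $p_j\in S^{\nu+j}_{1,0}(\mathbb R^m)$, $j\in\mathbb N_0$, such that $a(z,\mu)-\sum_{j=0}^{N-1}p_j(z)[z,\mu]^{d-\nu-j}\in\widetilde S^{d,\nu+N}_{1,0}(\mathbb R^m\times\overline{\mathbb R}_+)$ for every $N\in\mathbb N_0$; here $[z,\mu]$ is a smooth positive function that equals $|(z,\mu)|$ whenever $|(z,\mu)|\ge1$ (its choice is immaterial). * $\mathbf{\widetilde S}^{d,\nu}_{\mathrm{hom}}(\mathbb R^m\times\overline{\mathbb R}_+)$ is the space of functions $a(z,\mu)=|(z,\mu)|^d\,\widehat a\big((z,\mu)/|(z,\mu)|\big)$, $z\ne0$, $\mu\ge 0$, where $\widehat a$ is smooth on $\{(z,\mu)\in\mathbb R^m\times\overline{\mathbb R}_+ : |(z,\mu)|=1,\ z\neq0\}$ and $(r,\phi)\mapsto r^{-\nu}\,\widehat a(r\phi,\sqrt{1-r^2})$, defined on $(0,1)\times\mathbb S^{m-1}$, extends to a smooth function on $[0,1)\times\mathbb S^{m-1}$. * $\mathbf{\widetilde S}^{d,\nu}(\mathbb R^m\times\overline{\mathbb R}_+)$ (poly-homogeneous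 symbols with expansion at infinity) is the space of those $a\in\mathbf{\widetilde S}^{d,\nu}_{1,0}(\mathbb R^m\times\overline{\mathbb R}_+)$ for which there are $a_j\in\mathbf{\widetilde S}^{d-j,\nu-j}_{\mathrm{hom}}(\mathbb R^m\times\overline{\mathbb R}_+)$, $j\in\mathbb N_0$, such that $a-\chi\sum_{j=0}^{N-1}a_j\in\mathbf{\widetilde S}^{d-N,\nu-N}_{1,0}(\mathbb R^m\times\overline{\mathbb R}_+)$ for every $N\in\mathbb N_0$; here $\chi=\chi(z)$ is a smooth function on $\mathbb R^m$ that vanishes near $0$ and equals $1$ outside some ball (its choice is immaterial). **Theorem.** Let $a\in\mathbf{\widetilde S}^{d,\nu}(\mathbb R^m\times\overline{\mathbb R}_+)$ with $d<-m$. Then $a(\cdot,\mu)$ is integrable on $\mathbb R^m$ for every $\mu\ge0$, and there are coefficients $c_j,c'_\ell,c''_\ell\in\mathbb C$ ($j,\ell\in\mathbb N_0$), depending on $a$, such that $$\int_{\mathbb R^m}a(z,\mu)\,dz\ \sim\ \sum_{j=0}^{\infty}c_j\,\mu^{d+m-j}+\sum_{\ell=0}^{\infty}\big(c'_\ell\log\mu+c''_\ell\big)\mu^{d-\nu-\ell}\qquad(\mu\to+\infty),$$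 meaning that, for all $J,L\in\mathbb N_0$, as $\mu\to+\infty$, $$\int_{\mathbb R^m}a(z,\mu)\,dz-\sum_{j=0}^{J-1}c_j\,\mu^{d+m-j}-\sum_{\ell=0}^{L-1}\big(c'_\ell\log\mu+c''_\ell\big)\mu^{d-\nu-\ell}=O\big(\mu^{d+m-J}+(1+\log\mu)\,\mu^{d-\nu-L}\big).$$ -/

import Mathlib

open MeasureTheory Filter Asymptotics Set
open scoped ContDiff Topology

noncomputable section

namespace ParamSymbol

/-- The space `ℝ^m` with its Euclidean norm. -/
abbrev E (m : ℕ) : Type := EuclideanSpace ℝ (Fin m)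

/-- The Euclidean norm `|(z, μ)|` on `ℝ^m × ℝ`. -/
def pairNorm {m : ℕ} (z : E m) (μ : ℝ) : ℝ := √(‖z‖ ^ 2 + μ ^ 2)

/-- The bracket `⟨z⟩ = (1 + |z|²)^{1/2}`. -/
def jap {m : ℕ} (z : E m) : ℝ := √(1 + ‖z‖ ^ 2)

/-- The bracket `⟨z, μ⟩ = (1 + |z|² + μ²)^{1/2}`. -/
def japPair {m : ℕ} (z : E m) (μ : ℝ) : ℝ := √(1 + ‖z‖ ^ 2 + μ ^ 2)

/-- The Hörmander class `S^d_{1,0}(ℝ^m)`. The norm of the `k`-th Fréchet derivative is, up to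
constants depending on `m` and `k`, the maximum of `|∂^α p|` over all `|α| = k`. -/
def IsHormander {m : ℕ} (d : ℝ) (p : E m → ℂ) : Prop :=
  ContDiff ℝ ∞ p ∧
    ∀ k : ℕ, ∃ C : ℝ, ∀ z : E m, ‖iteratedFDeriv ℝ k p z‖ ≤ C * jap z ^ (d - k)

/-- Symbols with regularity number: the class `S̃^{d,ν}_{1,0}(ℝ^m × [0,∞))`. Only the values
`a z μ` with `μ ≥ 0` matter; smoothness and the derivatives in `μ` are one-sided at `μ = 0`. -/
def IsRegSymbol {m : ℕ} (d ν : ℝ) (a : E m → ℝ → ℂ) : Prop :=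
  ContDiffOn ℝ ∞ (fun x : E m × ℝ => a x.1 x.2) (univ ×ˢ Ici 0) ∧
    ∀ k j : ℕ, ∃ C : ℝ, ∀ (z : E m) (μ : ℝ), 0 ≤ μ →
      ‖iteratedFDeriv ℝ k (fun w : E m => iteratedDerivWithin j (a w) (Ici 0) μ) z‖ ≤
        C * jap z ^ (ν - k) * japPair z μ ^ (d - ν - j)

/-- `br` can serve as `[z, μ]`: a smooth positive function on `ℝ^m × [0,∞)` which coincides with
`|(z, μ)|` whenever `|(z, μ)| ≥ 1`. -/
structure IsSmoothedNorm {m : ℕ} (br : E m → ℝ → ℝ) : Prop where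
  smooth : ContDiffOn ℝ ∞ (fun x : E m × ℝ => br x.1 x.2) (univ ×ˢ Ici 0)
  pos : ∀ (z : E m) (μ : ℝ), 0 ≤ μ → 0 < br z μ
  eq_norm : ∀ (z : E m) (μ : ℝ), 0 ≤ μ → 1 ≤ pairNorm z μ → br z μ = pairNorm z μ

/-- Symbols with expansion at infinity: the class `𝐒̃^{d,ν}_{1,0}(ℝ^m × [0,∞))`. Two choices of
`[z, μ]` differ by a compactly supported function, so the class does not depend on the choice. -/
def IsExpSymbol {m : ℕ} (d ν : ℝ) (a : E m → ℝ → ℂ) : Prop :=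
  IsRegSymbol d ν a ∧
    ∃ br : E m → ℝ → ℝ, IsSmoothedNorm br ∧
      ∃ p : ℕ → E m → ℂ, (∀ j : ℕ, IsHormander (ν + j) (p j)) ∧
        ∀ N : ℕ, IsRegSymbol d (ν + N) (fun z μ =>
          a z μ - ∑ j ∈ Finset.range N, p j z * ((br z μ ^ (d - ν - j) : ℝ) : ℂ))

/-- The upper unit half-sphere in `ℝ^m × [0,∞)` with the north pole `(0, 1)` removed. -/
def puncturedHalfSphere (m : ℕ) : Set (E m × ℝ) :=
  {x | pairNorm x.1 x.2 = 1 ∧ 0 ≤ x.2 ∧ x.1 ≠ 0}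

/-- The class `C^{∞,ν}_T` of functions on the punctured half-sphere: `h` is smooth there, and
`(r, φ) ↦ r^{-ν} h(rφ, √(1-r²))` extends to a smooth function on `[0,1) × 𝕊^{m-1}`. On these
embedded submanifolds with boundary, `ContDiffOn` is the usual smoothness up to the boundary. -/
def IsWeightedTaylor {m : ℕ} (ν : ℝ) (h : E m → ℝ → ℂ) : Prop :=
  ContDiffOn ℝ ∞ (fun x : E m × ℝ => h x.1 x.2) (puncturedHalfSphere m) ∧
    ∃ b : ℝ → E m → ℂ,
      ContDiffOn ℝ ∞ (fun y : ℝ × E m => b y.1 y.2) (Ico 0 1 ×ˢ Metric.sphere 0 1) ∧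
      ∀ r ∈ Ioo (0 : ℝ) 1, ∀ φ ∈ Metric.sphere (0 : E m) 1,
        b r φ = ((r ^ (-ν) : ℝ) : ℂ) * h (r • φ) (√(1 - r ^ 2))

/-- The homogeneous class `𝐒̃^{d,ν}_hom(ℝ^m × [0,∞))`: the extensions, homogeneous of degree `d`,
of functions in `C^{∞,ν}_T`. They are defined for `z ≠ 0`, `μ ≥ 0`; other values are ignored. -/
def IsHomSymbol {m : ℕ} (d ν : ℝ) (a : E m → ℝ → ℂ) : Prop :=
  ∃ h : E m → ℝ → ℂ, IsWeightedTaylor ν h ∧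
    ∀ (z : E m) (μ : ℝ), z ≠ 0 → 0 ≤ μ →
      a z μ = ((pairNorm z μ ^ d : ℝ) : ℂ) *
        h ((pairNorm z μ)⁻¹ • z) ((pairNorm z μ)⁻¹ * μ)

/-- Zero-excision functions: smooth, vanishing near `0`, equal to `1` outside some ball. -/
structure IsZeroExcision {m : ℕ} (χ : E m → ℝ) : Prop where
  smooth : ContDiff ℝ ∞ χ
  zero_near : ∀ᶠ z in 𝓝 (0 : E m), χ z = 0
  one_far : ∃ R : ℝ, ∀ z : E m, R ≤ ‖z‖ → χ z = 1

/-- Poly-homogeneous symbols with expansion at infinity: the class `𝐒̃^{d,ν}(ℝ^m × [0,∞))`.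
The class does not depend on the choice of the zero-excision function. -/
def IsPolyhomSymbol {m : ℕ} (d ν : ℝ) (a : E m → ℝ → ℂ) : Prop :=
  IsExpSymbol d ν a ∧
    ∃ χ : E m → ℝ, IsZeroExcision χ ∧
      ∃ A : ℕ → E m → ℝ → ℂ, (∀ j : ℕ, IsHomSymbol (d - j) (ν - j) (A j)) ∧
        ∀ N : ℕ, IsExpSymbol (d - N) (ν - N) (fun z μ =>
          a z μ - (χ z : ℂ) * ∑ j ∈ Finset.range N, A j z μ)

end ParamSymbol

end

noncomputable section

namespace ParamSymbol

/-! ### Japanese brackets -/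

/-! Write `a` as `χ` times the sum of its homogeneous components `A j`, `j < N`, plus a remainder,
and integrate the pieces separately.

Homogeneous pieces: substituting `z = μ w` turns `∫ χ(z) A_j(z, μ) dz` into `μ^(d-j+m) ∫ χ(μ w)
A_j(w, 1) dw`. Taylor expansion at the pole of the half-sphere makes `A_j(w, 1)` near `w = 0` a sum
of functions homogeneous of degree `ν - j + k` plus a small error. Letting the excision shrink gives
a constant, which becomes `c_j μ^(d+m-j)`, and for each `k` a term of size `μ^(d-ν-k)`. A logarithm
appears only for the critical degree `ν - j + k = -m`, through `∫ dr/r`. This is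
`IsZeroExcision.exists_logExpansion`, applied in `IsHomSymbol.exists_logExpansion`.

Remainder: it has order `d - N` and regularity `ν - N`, so the difference `d - ν` is unchanged while
its coefficients decay in `z` as fast as desired. Expanding `|(z, μ)|^q` binomially in `|z|²/μ²` and
integrating termwise gives powers `μ^(d-ν-l)` without logarithms
(`IsExpSymbol.hasPowerExpansion_integral`).

Every `A j` contributes to each power `μ^(d-ν-l)`. The log coefficient receives a nonzero
contribution from at most one `j`, hence stabilises in `N`. The pure power coefficients come from
`N`-dependent decompositions and are made independent of `N` by uniqueness of asymptotic
coefficients (`exists_common_coefficients`). -/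

lemma one_le_jap {m : ℕ} (z : E m) : 1 ≤ jap z := by
  rw [jap, Real.one_le_sqrt]; nlinarith [sq_nonneg ‖z‖]

lemma jap_pos {m : ℕ} (z : E m) : 0 < jap z := zero_lt_one.trans_le (one_le_jap z)

lemma norm_le_jap {m : ℕ} (z : E m) : ‖z‖ ≤ jap z :=
  Real.le_sqrt_of_sq_le (by linarith)

/-- `⟨z,μ⟩` lies between `⟨μ⟩` and `⟨z⟩⟨μ⟩`. This form keeps the exact power of `μ` and pays with
growth in `z`; it serves remainders that decay fast in `z`. -/
lemma japPair_rpow_le {m : ℕ} (z : E m) (μ s : ℝ) :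
    japPair z μ ^ s ≤ jap z ^ |s| * √(1 + μ ^ 2) ^ s := by
  have hμ : 0 < √(1 + μ ^ 2) := by positivity
  rcases le_or_gt 0 s with hs | hs
  · rw [abs_of_nonneg hs, ← Real.mul_rpow (jap_pos z).le hμ.le]
    refine Real.rpow_le_rpow (Real.sqrt_nonneg _) ?_ hs
    rw [japPair, jap, ← Real.sqrt_mul (by positivity)]
    exact Real.sqrt_le_sqrt (by nlinarith [mul_nonneg (sq_nonneg ‖z‖) (sq_nonneg μ)])
  · refine (Real.rpow_le_rpow_of_nonpos hμ ?_ hs.le).trans ?_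
    · exact Real.sqrt_le_sqrt (by nlinarith [sq_nonneg ‖z‖])
    · exact le_mul_of_one_le_left (by positivity)
        (Real.one_le_rpow (one_le_jap z) (abs_nonneg s))

lemma integrable_jap_rpow {m : ℕ} {t : ℝ} (ht : t < -(m : ℝ)) :
    Integrable (fun z : E m => jap z ^ t) volume := by
  have h := integrable_rpow_neg_one_add_norm_sq (E := E m) (μ := volume) (r := -t)
    (by simp; linarith)
  refine h.congr (Eventually.of_forall fun z => ?_)
  simp only [jap, neg_neg]
  rw [Real.rpow_div_two_eq_sqrt _ (by positivity)]

lemma integrable_of_norm_le_jap {m : ℕ} {t C : ℝ} (ht : t < -(m : ℝ)) {f : E m → ℂ}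
    (hf : Continuous f) (hb : ∀ z, ‖f z‖ ≤ C * jap z ^ t) : Integrable f volume :=
  ((integrable_jap_rpow ht).const_mul C).mono' hf.aestronglyMeasurable (Eventually.of_forall hb)

/-! ### Consequences of the symbol estimates -/

lemma IsHormander.exists_norm_le {m : ℕ} {d : ℝ} {p : E m → ℂ} (hp : IsHormander d p) :
    ∃ C, 0 ≤ C ∧ ∀ z, ‖p z‖ ≤ C * jap z ^ d := by
  obtain ⟨C, hC⟩ := hp.2 0
  refine ⟨|C|, abs_nonneg C, fun z => ?_⟩
  have h := hC z
  simp only [norm_iteratedFDeriv_zero, Nat.cast_zero, sub_zero] at h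
  exact h.trans (mul_le_mul_of_nonneg_right (le_abs_self C) (Real.rpow_nonneg (jap_pos z).le _))

lemma IsRegSymbol.exists_norm_le {m : ℕ} {d ν : ℝ} {a : E m → ℝ → ℂ} (ha : IsRegSymbol d ν a) :
    ∃ C, 0 ≤ C ∧ ∀ z μ, 0 ≤ μ →
      ‖a z μ‖ ≤ C * jap z ^ (ν + |d - ν|) * √(1 + μ ^ 2) ^ (d - ν) := by
  obtain ⟨C, hC⟩ := ha.2 0 0
  refine ⟨|C|, abs_nonneg C, fun z μ hμ => ?_⟩
  have h := hC z μ hμ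
  simp only [norm_iteratedFDeriv_zero, Nat.cast_zero, sub_zero, iteratedDerivWithin_zero] at h
  have hj := jap_pos z
  calc ‖a z μ‖ ≤ C * jap z ^ ν * japPair z μ ^ (d - ν) := h
    _ ≤ |C| * jap z ^ ν * (jap z ^ |d - ν| * √(1 + μ ^ 2) ^ (d - ν)) := by
        have : 0 ≤ japPair z μ ^ (d - ν) := Real.rpow_nonneg (Real.sqrt_nonneg _) _
        gcongr
        · exact le_abs_self C
        · exact japPair_rpow_le z μ _
    _ = _ := by rw [Real.rpow_add hj]; ring

lemma IsRegSymbol.continuous {m : ℕ} {d ν : ℝ} {a : E m → ℝ → ℂ} (ha : IsRegSymbol d ν a)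
    {μ : ℝ} (hμ : 0 ≤ μ) : Continuous (fun z => a z μ) := by
  have h : ContinuousOn ((fun x : E m × ℝ => a x.1 x.2) ∘ fun z => (z, μ)) univ :=
    ha.1.continuousOn.comp (by fun_prop) (fun z _ => ⟨mem_univ _, hμ⟩)
  exact continuousOn_univ.1 h

/-- The companion bound with the roles exchanged: the exact power of `⟨z⟩` is kept and `μ` pays. It
yields integrability at fixed `μ` under the bare condition `d < -m`. -/
lemma japPair_rpow_le_jap {m : ℕ} (z : E m) (μ s : ℝ) :
    japPair z μ ^ s ≤ jap z ^ s * √(1 + μ ^ 2) ^ |s| := by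
  have hμ : 1 ≤ √(1 + μ ^ 2) := by rw [Real.one_le_sqrt]; nlinarith
  have hz := jap_pos z
  rcases le_or_gt 0 s with hs | hs
  · rw [abs_of_nonneg hs, ← Real.mul_rpow (jap_pos z).le (by positivity)]
    refine Real.rpow_le_rpow (Real.sqrt_nonneg _) ?_ hs
    rw [japPair, jap, ← Real.sqrt_mul (by positivity)]
    exact Real.sqrt_le_sqrt (by nlinarith [mul_nonneg (sq_nonneg ‖z‖) (sq_nonneg μ)])
  · refine (Real.rpow_le_rpow_of_nonpos hz ?_ hs.le).trans ?_
    · exact Real.sqrt_le_sqrt (by nlinarith [sq_nonneg μ])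
    · exact le_mul_of_one_le_right (by positivity) (Real.one_le_rpow hμ (abs_nonneg s))

lemma IsRegSymbol.integrable {m : ℕ} {d ν : ℝ} {a : E m → ℝ → ℂ} (ha : IsRegSymbol d ν a)
    (hd : d < -(m : ℝ)) {μ : ℝ} (hμ : 0 ≤ μ) : Integrable (fun z => a z μ) volume := by
  obtain ⟨C, hC⟩ := ha.2 0 0
  refine integrable_of_norm_le_jap (C := |C| * √(1 + μ ^ 2) ^ |d - ν|) hd (ha.continuous hμ)
    fun z => ?_
  have h := hC z μ hμ
  simp only [norm_iteratedFDeriv_zero, Nat.cast_zero, sub_zero, iteratedDerivWithin_zero] at h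
  have hj := jap_pos z
  calc ‖a z μ‖ ≤ C * jap z ^ ν * japPair z μ ^ (d - ν) := h
    _ ≤ |C| * jap z ^ ν * (jap z ^ (d - ν) * √(1 + μ ^ 2) ^ |d - ν|) := by
        have : 0 ≤ japPair z μ ^ (d - ν) := Real.rpow_nonneg (Real.sqrt_nonneg _) _
        gcongr
        · exact le_abs_self C
        · exact japPair_rpow_le_jap z μ _
    _ = |C| * √(1 + μ ^ 2) ^ |d - ν| * jap z ^ (ν + (d - ν)) := by rw [Real.rpow_add hj]; ring
    _ = _ := by congr 2; ring

/-! ### Finite expansions in powers -/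

lemma isBigO_rpow_rpow_atTop {s t : ℝ} (h : s ≤ t) :
    (fun μ : ℝ => μ ^ s) =O[atTop] fun μ : ℝ => μ ^ t := by
  refine IsBigO.of_bound 1 ?_
  filter_upwards [eventually_ge_atTop 1] with μ hμ
  rw [one_mul, Real.norm_of_nonneg (by positivity), Real.norm_of_nonneg (by positivity)]
  exact Real.rpow_le_rpow_of_exponent_le hμ h

lemma isBigO_const_mul_ofReal_rpow {s t : ℝ} (h : s ≤ t) (c : ℂ) :
    (fun μ : ℝ => c * ((μ ^ s : ℝ) : ℂ)) =O[atTop] fun μ : ℝ => μ ^ t := by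
  refine IsBigO.const_mul_left ?_ c
  exact (IsBigO.of_norm_left (by simpa using (isBigO_rpow_rpow_atTop h).norm_left))

/-- `F` has an expansion in the powers `μ ^ (s - l)`, `l < L`, as `μ → ∞`. -/
def HasPowerExpansion (s : ℝ) (L : ℕ) (F : ℝ → ℂ) : Prop :=
  ∃ x : ℕ → ℂ, (fun μ : ℝ => F μ - ∑ l ∈ Finset.range L, x l * ((μ ^ (s - l) : ℝ) : ℂ))
    =O[atTop] fun μ : ℝ => μ ^ (s - L)

namespace HasPowerExpansion

variable {s : ℝ} {L : ℕ} {F G : ℝ → ℂ}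

lemma of_isBigO (h : F =O[atTop] fun μ : ℝ => μ ^ (s - L)) : HasPowerExpansion s L F :=
  ⟨0, by simpa using h⟩

lemma add (hF : HasPowerExpansion s L F) (hG : HasPowerExpansion s L G) :
    HasPowerExpansion s L (fun μ => F μ + G μ) := by
  obtain ⟨x, hx⟩ := hF
  obtain ⟨y, hy⟩ := hG
  refine ⟨x + y, (hx.add hy).congr_left fun μ => ?_⟩
  simp only [Pi.add_apply, add_mul, Finset.sum_add_distrib]
  ring

lemma sum {ι : Type*} (S : Finset ι) {F : ι → ℝ → ℂ}
    (h : ∀ i ∈ S, HasPowerExpansion s L (F i)) :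
    HasPowerExpansion s L (fun μ => ∑ i ∈ S, F i μ) := by
  classical
  induction S using Finset.induction_on with
  | empty => exact of_isBigO (by simpa using isBigO_zero _ _)
  | insert i S hi ih =>
    simp only [Finset.sum_insert hi]
    exact (h i (by simp)).add (ih fun k hk => h k (by simp [hk]))

lemma congr' (hF : HasPowerExpansion s L F) (h : F =ᶠ[atTop] G) : HasPowerExpansion s L G := by
  obtain ⟨x, hx⟩ := hF
  refine ⟨x, hx.congr' ?_ EventuallyEq.rfl⟩
  filter_upwards [h] with μ hμ
  rw [hμ]

/-- A power beyond the truncation (`l ≥ L`) is absorbed by the error, so sums may contain more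
powers than the expansion records. -/
lemma const_mul_rpow (c : ℂ) (l : ℕ) :
    HasPowerExpansion s L (fun μ => c * ((μ ^ (s - l) : ℝ) : ℂ)) := by
  rcases lt_or_ge l L with h | h
  · refine ⟨Pi.single l c, ?_⟩
    have : ∀ μ : ℝ, c * ((μ ^ (s - l) : ℝ) : ℂ) - ∑ i ∈ Finset.range L,
        (Pi.single l c : ℕ → ℂ) i * ((μ ^ (s - i) : ℝ) : ℂ) = 0 := fun μ => by
      rw [Finset.sum_eq_single l]
      · simp
      · intro i _ hi; simp [hi]
      · intro hl; exact absurd (Finset.mem_range.2 h) hl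
    simpa only [this] using isBigO_zero _ _
  · exact of_isBigO (isBigO_const_mul_ofReal_rpow (by
      have : (L : ℝ) ≤ l := by exact_mod_cast h
      linarith) c)

end HasPowerExpansion

/-! ### Binomial expansion of the smoothed norm -/

/-- Taylor's theorem handles `t ≤ 1`. For `t > 1` nothing needs to cancel: `t ^ K` dominates every
monomial of the polynomial, and the factor `(1 + t) ^ |σ|` covers the function itself. -/
lemma exists_one_add_rpow_expansion (σ : ℝ) (K : ℕ) :
    ∃ (e : ℕ → ℝ) (C : ℝ), 0 ≤ C ∧ ∀ t : ℝ, 0 ≤ t →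
      |(1 + t) ^ σ - ∑ k ∈ Finset.range K, e k * t ^ k| ≤ C * (t ^ K * (1 + t) ^ |σ|) := by
  have hle : ∀ t : ℝ, 0 ≤ t → (1 + t) ^ σ ≤ (1 + t) ^ |σ| := fun t ht =>
    Real.rpow_le_rpow_of_exponent_le (by linarith) (le_abs_self σ)
  rcases K with _ | n
  · refine ⟨0, 1, zero_le_one, fun t ht => ?_⟩
    have : (0 : ℝ) ≤ (1 + t) ^ σ := by positivity
    simpa [abs_of_nonneg this] using hle t ht
  have hsm : ContDiffOn ℝ (n + 1) (fun t : ℝ => (1 + t) ^ σ) (Icc 0 1) := by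
    refine ContDiffOn.rpow_const_of_ne (by fun_prop) fun t ht => ?_
    have := ht.1
    positivity
  obtain ⟨C, hC⟩ := exists_taylor_mean_remainder_bound zero_le_one hsm
  set e : ℕ → ℝ := fun k => (k.factorial : ℝ)⁻¹ *
    iteratedDerivWithin k (fun t : ℝ => (1 + t) ^ σ) (Icc 0 1) 0 with he
  refine ⟨e, |C| + 1 + ∑ k ∈ Finset.range (n + 1), |e k|, by positivity, fun t ht => ?_⟩
  have h1 : (1 : ℝ) ≤ (1 + t) ^ |σ| := Real.one_le_rpow (by linarith) (abs_nonneg σ)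
  have hS : 0 ≤ ∑ k ∈ Finset.range (n + 1), |e k| := by positivity
  rcases le_or_gt t 1 with ht1 | ht1
  · have h := hC t ⟨ht, ht1⟩
    rw [taylor_within_apply, Real.norm_eq_abs] at h
    have hEq : ∑ k ∈ Finset.range (n + 1), ((k.factorial : ℝ)⁻¹ * (t - 0) ^ k) •
        iteratedDerivWithin k (fun t : ℝ => (1 + t) ^ σ) (Icc 0 1) 0
        = ∑ k ∈ Finset.range (n + 1), e k * t ^ k :=
      Finset.sum_congr rfl fun k _ => by simp only [he, sub_zero, smul_eq_mul]; ring
    rw [hEq, sub_zero] at h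
    refine h.trans ?_
    have : t ^ (n + 1) ≤ t ^ (n + 1) * (1 + t) ^ |σ| := le_mul_of_one_le_right (by positivity) h1
    refine mul_le_mul ?_ this (by positivity) (by positivity)
    linarith [le_abs_self C]
  · have hp : (1 : ℝ) ≤ t ^ (n + 1) := one_le_pow₀ ht1.le
    have hA : |(1 + t) ^ σ| ≤ t ^ (n + 1) * (1 + t) ^ |σ| := by
      rw [abs_of_nonneg (by positivity)]
      exact (hle t ht).trans (le_mul_of_one_le_left (by positivity) hp)
    have hB : |∑ k ∈ Finset.range (n + 1), e k * t ^ k| ≤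
        (∑ k ∈ Finset.range (n + 1), |e k|) * (t ^ (n + 1) * (1 + t) ^ |σ|) := by
      refine (Finset.abs_sum_le_sum_abs _ _).trans ?_
      rw [Finset.sum_mul]
      refine Finset.sum_le_sum fun k hk => ?_
      rw [abs_mul, abs_of_nonneg (show 0 ≤ t ^ k by positivity)]
      refine mul_le_mul_of_nonneg_left ?_ (abs_nonneg _)
      exact (pow_le_pow_right₀ ht1.le (Finset.mem_range.1 hk).le).trans
        (le_mul_of_one_le_right (by positivity) h1)
    calc _ ≤ |(1 + t) ^ σ| + |∑ k ∈ Finset.range (n + 1), e k * t ^ k| := abs_sub _ _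
      _ ≤ 1 * (t ^ (n + 1) * (1 + t) ^ |σ|) +
        (∑ k ∈ Finset.range (n + 1), |e k|) * (t ^ (n + 1) * (1 + t) ^ |σ|) := by
          rw [one_mul]; exact add_le_add hA hB
      _ ≤ _ := by
        rw [← add_mul]
        exact mul_le_mul_of_nonneg_right (by linarith [abs_nonneg C]) (by positivity)

lemma pairNorm_rpow_eq {m : ℕ} (z : E m) {μ : ℝ} (hμ : 0 < μ) (q : ℝ) :
    pairNorm z μ ^ q = μ ^ q * (1 + ‖z‖ ^ 2 / μ ^ 2) ^ (q / 2) := by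
  have h : ‖z‖ ^ 2 + μ ^ 2 = μ ^ 2 * (1 + ‖z‖ ^ 2 / μ ^ 2) := by field_simp; ring
  rw [pairNorm, ← Real.rpow_div_two_eq_sqrt _ (by positivity), h,
    Real.mul_rpow (by positivity) (by positivity), Real.rpow_div_two_eq_sqrt _ (by positivity),
    Real.sqrt_sq hμ.le]

/-- Pull out `μ ^ (s - i)` and expand the rest in `‖z‖² / μ²`; the coefficients are moments of `p`.
Hypothesis `ht` is the decay needed to integrate the binomial remainder, whose weight is `⟨z⟩ ^ (2L
+ |s - i|)`. -/
lemma hasPowerExpansion_integral_mul_pairNorm {m : ℕ} {t C : ℝ} {p : E m → ℂ}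
    (hp : Continuous p) (hC : 0 ≤ C) (hb : ∀ z, ‖p z‖ ≤ C * jap z ^ t) (s : ℝ) (i L : ℕ)
    (ht : t + 2 * L + |s - i| < -(m : ℝ)) :
    HasPowerExpansion s L
      (fun μ => ∫ z, p z * ((pairNorm z μ ^ (s - i) : ℝ) : ℂ)) := by
  obtain ⟨e, D, hD, he⟩ := exists_one_add_rpow_expansion ((s - i) / 2) L
  have hint : ∀ k ∈ Finset.range L, Integrable (fun z => p z * ((‖z‖ ^ (2 * k) : ℝ) : ℂ)) := by
    intro k hk
    have hk' : (k : ℝ) ≤ L := by exact_mod_cast (Finset.mem_range.1 hk).le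
    refine integrable_of_norm_le_jap (t := t + 2 * k) (C := C)
      (by linarith [abs_nonneg (s - i)]) (by fun_prop) fun z => ?_
    rw [norm_mul, Complex.norm_real, Real.norm_of_nonneg (by positivity),
      Real.rpow_add (jap_pos z), ← mul_assoc]
    refine mul_le_mul (hb z) ?_ (by positivity) ((norm_nonneg _).trans (hb z))
    have : jap z ^ (2 * (k : ℝ)) = jap z ^ (2 * k) := by
      rw [← Real.rpow_natCast]; push_cast; rfl
    rw [this]
    exact pow_le_pow_left₀ (norm_nonneg z) (norm_le_jap z) _
  set R : ℝ → E m → ℂ := fun μ z => p z * ((μ ^ (s - i) * ((1 + ‖z‖ ^ 2 / μ ^ 2) ^ ((s - i) / 2) -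
    ∑ k ∈ Finset.range L, e k * (‖z‖ ^ 2 / μ ^ 2) ^ k) : ℝ) : ℂ) with hR
  have hRc : ∀ μ, Continuous (R μ) := fun μ => by
    have : Continuous fun z : E m => (1 + ‖z‖ ^ 2 / μ ^ 2) ^ ((s - i) / 2) :=
      Continuous.rpow_const (by fun_prop) fun z => Or.inl (by positivity)
    simp only [hR]
    fun_prop
  have hRb : ∀ μ, 1 ≤ μ → ∀ z, ‖R μ z‖ ≤
      (C * D * μ ^ (s - i - 2 * L)) * jap z ^ (t + 2 * L + |s - i|) := by
    intro μ hμ z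
    have hμ0 : 0 < μ := by linarith
    have hj := jap_pos z
    have h1 := he (‖z‖ ^ 2 / μ ^ 2) (by positivity)
    have h2 : (‖z‖ ^ 2 / μ ^ 2) ^ L ≤ jap z ^ (2 * (L : ℝ)) * μ ^ (-(2 * (L : ℝ))) := by
      have e1 : jap z ^ (2 * (L : ℝ)) = jap z ^ (2 * L) := by
        rw [← Real.rpow_natCast]; push_cast; rfl
      have e2 : μ ^ (2 * (L : ℝ)) = μ ^ (2 * L) := by
        rw [← Real.rpow_natCast]; push_cast; rfl
      rw [Real.rpow_neg hμ0.le, e1, e2, ← div_eq_mul_inv, div_pow, ← pow_mul, ← pow_mul]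
      gcongr
      exact norm_le_jap z
    have h3 : (1 + ‖z‖ ^ 2 / μ ^ 2) ^ |(s - i) / 2| ≤ jap z ^ |s - i| := by
      have : (1 + ‖z‖ ^ 2 / μ ^ 2) ≤ 1 + ‖z‖ ^ 2 := by
        gcongr
        exact div_le_self (by positivity) (one_le_pow₀ hμ)
      refine (Real.rpow_le_rpow (by positivity) this (abs_nonneg _)).trans ?_
      rw [abs_div, abs_two, jap, Real.rpow_div_two_eq_sqrt _ (by positivity)]
    rw [hR, norm_mul, Complex.norm_real, Real.norm_eq_abs, abs_mul,
      abs_of_nonneg (show 0 ≤ μ ^ (s - i) by positivity)]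
    calc ‖p z‖ * (μ ^ (s - i) * |(1 + ‖z‖ ^ 2 / μ ^ 2) ^ ((s - i) / 2) -
          ∑ k ∈ Finset.range L, e k * (‖z‖ ^ 2 / μ ^ 2) ^ k|)
        ≤ (C * jap z ^ t) * (μ ^ (s - i) * (D * ((jap z ^ (2 * (L : ℝ)) * μ ^ (-(2 * (L : ℝ)))) *
          jap z ^ |s - i|))) := by
          gcongr
          · exact hb z
          · refine h1.trans ?_
            gcongr
      _ = _ := by
        rw [Real.rpow_add hj, Real.rpow_add hj, sub_eq_add_neg (s - i), Real.rpow_add hμ0]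
        ring
  have hRi : ∀ μ, 1 ≤ μ → Integrable (R μ) := fun μ hμ =>
    integrable_of_norm_le_jap ht (hRc μ) (hRb μ hμ)
  have hsum : HasPowerExpansion s L (fun μ => (∑ k ∈ Finset.range L,
      (e k : ℂ) * (∫ z, p z * ((‖z‖ ^ (2 * k) : ℝ) : ℂ)) * ((μ ^ (s - (i + 2 * k : ℕ)) : ℝ) : ℂ)) +
        ∫ z, R μ z) := by
    refine (HasPowerExpansion.sum _ fun k _ => HasPowerExpansion.const_mul_rpow _ _).add ?_
    refine HasPowerExpansion.of_isBigO (IsBigO.of_bound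
      (C * D * ∫ z : E m, jap z ^ (t + 2 * L + |s - i|)) ?_)
    filter_upwards [eventually_ge_atTop 1] with μ hμ
    have hI : 0 ≤ ∫ z : E m, jap z ^ (t + 2 * L + |s - i|) :=
      integral_nonneg fun z => Real.rpow_nonneg (jap_pos z).le _
    have := norm_integral_le_of_norm_le ((integrable_jap_rpow ht).const_mul
      (C * D * μ ^ (s - i - 2 * L))) (Eventually.of_forall (hRb μ hμ))
    rw [integral_const_mul] at this
    refine this.trans ?_
    rw [Real.norm_of_nonneg (by positivity), mul_right_comm]
    refine mul_le_mul_of_nonneg_left (Real.rpow_le_rpow_of_exponent_le hμ ?_) (by positivity)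
    have : (0 : ℝ) ≤ i := by positivity
    have : (0 : ℝ) ≤ L := by positivity
    linarith
  refine hsum.congr' ?_
  filter_upwards [eventually_ge_atTop 1] with μ hμ
  have hμ0 : 0 < μ := by linarith
  have hpt : ∀ z, p z * ((pairNorm z μ ^ (s - i) : ℝ) : ℂ) = (∑ k ∈ Finset.range L,
      ((e k : ℂ) * ((μ ^ (s - (i + 2 * k : ℕ)) : ℝ) : ℂ)) * (p z * ((‖z‖ ^ (2 * k) : ℝ) : ℂ)))
        + R μ z := by
    intro z
    have key : ∀ k : ℕ, μ ^ (s - (i + 2 * k : ℕ)) * ‖z‖ ^ (2 * k) =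
        μ ^ (s - i) * (‖z‖ ^ 2 / μ ^ 2) ^ k := fun k => by
      have : s - ((i + 2 * k : ℕ) : ℝ) = (s - i) - ((2 * k : ℕ) : ℝ) := by push_cast; ring
      rw [this, Real.rpow_sub hμ0 (s - i), Real.rpow_natCast, div_pow, ← pow_mul, ← pow_mul]
      ring
    have hs : ∑ k ∈ Finset.range L,
        ((e k : ℂ) * ((μ ^ (s - (i + 2 * k : ℕ)) : ℝ) : ℂ)) * (p z * ((‖z‖ ^ (2 * k) : ℝ) : ℂ))
        = p z * ((μ ^ (s - i) * ∑ k ∈ Finset.range L, e k * (‖z‖ ^ 2 / μ ^ 2) ^ k : ℝ) : ℂ) := by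
      rw [Finset.mul_sum, Complex.ofReal_sum, Finset.mul_sum]
      refine Finset.sum_congr rfl fun k _ => ?_
      have := congrArg (fun x : ℝ => (x : ℂ)) (key k)
      simp only [Complex.ofReal_mul] at this ⊢
      linear_combination (e k : ℂ) * p z * this
    rw [hs, hR, ← mul_add, ← Complex.ofReal_add, pairNorm_rpow_eq z hμ0]
    congr 2
    ring
  simp_rw [hpt]
  rw [integral_add (integrable_finsetSum _ fun k hk => (hint k hk).const_mul _) (hRi μ hμ),
    integral_finsetSum _ fun k hk => (hint k hk).const_mul _]
  congr 1
  refine Finset.sum_congr rfl fun k _ => ?_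
  rw [integral_const_mul]
  ring

/-! ### Integrals of symbols with expansion at infinity. -/

lemma isBigO_sqrt_one_add_sq_rpow (s : ℝ) :
    (fun μ : ℝ => √(1 + μ ^ 2) ^ s) =O[atTop] fun μ : ℝ => μ ^ s := by
  refine IsBigO.of_bound (√2 ^ |s|) ?_
  filter_upwards [eventually_ge_atTop 1] with μ hμ
  rw [Real.norm_of_nonneg (by positivity), Real.norm_of_nonneg (by positivity)]
  have h0 : 1 ≤ √2 := by rw [Real.one_le_sqrt]; norm_num
  rcases le_or_gt 0 s with hs | hs
  · rw [abs_of_nonneg hs, ← Real.mul_rpow (by positivity) (by positivity)]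
    refine Real.rpow_le_rpow (by positivity) ?_ hs
    rw [Real.sqrt_le_left (by positivity), mul_pow, Real.sq_sqrt (by norm_num)]
    nlinarith
  · refine (Real.rpow_le_rpow_of_nonpos (by linarith) ?_ hs.le).trans
      (le_mul_of_one_le_left (by positivity) (Real.one_le_rpow h0 (abs_nonneg s)))
    exact Real.le_sqrt_of_sq_le (by linarith)

/-- For `ν` this negative, all of the first `L` coefficients `p j` have enough moments, and the
symbol remainder integrates to `O(μ ^ (s - L))`. The separate variable `s` fits the shifted orders
`d - N`, `ν - N`, whose difference does not depend on `N`. -/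
lemma IsExpSymbol.hasPowerExpansion_integral {m : ℕ} {d ν s : ℝ} {a : E m → ℝ → ℂ}
    (ha : IsExpSymbol d ν a) (hs : d - ν = s) (L : ℕ) (hν : ν + 4 * L + |s| < -(m : ℝ)) :
    HasPowerExpansion s L (fun μ => ∫ z, a z μ) := by
  subst hs
  obtain ⟨-, br, hbr, p, hp, hrem⟩ := ha
  have hrem := hrem L
  have habs : ∀ i : ℕ, |d - ν - i| ≤ |d - ν| + i := fun i => by
    simpa using abs_sub (d - ν) (i : ℝ)
  choose C hC0 hC using fun j => (hp j).exists_norm_le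
  obtain ⟨D, hD0, hD⟩ := hrem.exists_norm_le
  have hrt : ν + L + |d - (ν + L)| < -(m : ℝ) := by
    have := habs L
    rw [sub_sub] at this
    have : (0 : ℝ) ≤ L := by positivity
    linarith
  have hpi : ∀ i ∈ Finset.range L, ∀ μ : ℝ, 1 ≤ μ → Integrable
      (fun z => p i z * ((pairNorm z μ ^ (d - ν - i) : ℝ) : ℂ)) := by
    intro i hi μ hμ
    have hi' : (i : ℝ) ≤ L := by exact_mod_cast (Finset.mem_range.1 hi).le
    have hc : Continuous fun z : E m => pairNorm z μ ^ (d - ν - i) :=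
      Continuous.rpow_const (by unfold pairNorm; fun_prop)
        fun z => Or.inl (by unfold pairNorm; positivity)
    have := (hp i).1.continuous
    refine integrable_of_norm_le_jap (t := ν + i + |d - ν - i|)
      (C := C i * μ ^ (d - ν - i)) (by linarith [habs i]) (by fun_prop) fun z => ?_
    have hj := jap_pos z
    rw [norm_mul, Complex.norm_real, Real.norm_of_nonneg (by unfold pairNorm; positivity),
      Real.rpow_add hj, pairNorm_rpow_eq z (by linarith)]
    have h3 : (1 + ‖z‖ ^ 2 / μ ^ 2) ^ ((d - ν - i) / 2) ≤ jap z ^ |d - ν - i| := by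
      have h0 : (1 + ‖z‖ ^ 2 / μ ^ 2) ≤ 1 + ‖z‖ ^ 2 := by
        gcongr
        exact div_le_self (by positivity) (one_le_pow₀ hμ)
      refine (Real.rpow_le_rpow_of_exponent_le (by
        have : 0 ≤ ‖z‖ ^ 2 / μ ^ 2 := by positivity
        linarith) (le_abs_self _)).trans ?_
      refine (Real.rpow_le_rpow (by positivity) h0 (abs_nonneg _)).trans ?_
      rw [abs_div, abs_two, jap, Real.rpow_div_two_eq_sqrt _ (by positivity)]
    calc _ ≤ (C i * jap z ^ (ν + i)) * (μ ^ (d - ν - i) * jap z ^ |d - ν - i|) := by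
          have := hC0 i
          gcongr
          exact hC i z
      _ = _ := by ring
  have hsum : HasPowerExpansion (d - ν) L (fun μ =>
      (∑ i ∈ Finset.range L, ∫ z, p i z * ((pairNorm z μ ^ (d - ν - i) : ℝ) : ℂ)) +
      ∫ z, (a z μ - ∑ j ∈ Finset.range L, p j z * ((br z μ ^ (d - ν - j) : ℝ) : ℂ))) := by
    refine (HasPowerExpansion.sum _ fun i hi => ?_).add ?_
    · have hi' : (i : ℝ) ≤ L := by exact_mod_cast (Finset.mem_range.1 hi).le
      exact hasPowerExpansion_integral_mul_pairNorm (hp i).1.continuous (hC0 i) (hC i) _ i L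
        (by linarith [habs i])
    · refine HasPowerExpansion.of_isBigO ?_
      have h0 : (fun μ : ℝ => ∫ z, (a z μ - ∑ j ∈ Finset.range L,
          p j z * ((br z μ ^ (d - ν - j) : ℝ) : ℂ))) =O[atTop]
          fun μ : ℝ => √(1 + μ ^ 2) ^ (d - (ν + L)) := by
        refine IsBigO.of_bound (D * ∫ z : E m, jap z ^ (ν + L + |d - (ν + L)|)) ?_
        filter_upwards [eventually_ge_atTop 0] with μ hμ
        have := norm_integral_le_of_norm_le ((integrable_jap_rpow hrt).const_mul
          (D * √(1 + μ ^ 2) ^ (d - (ν + L)))) (Eventually.of_forall fun z =>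
            (hD z μ hμ).trans_eq (mul_right_comm _ _ _))
        rw [integral_const_mul] at this
        refine this.trans_eq ?_
        rw [Real.norm_of_nonneg (by positivity)]
        ring
      rw [sub_sub]
      exact h0.trans (isBigO_sqrt_one_add_sq_rpow _)
  refine hsum.congr' ?_
  filter_upwards [eventually_ge_atTop 1] with μ hμ
  have hμ0 : 0 ≤ μ := by linarith
  -- For `μ ≥ 1` the smoothing of the norm is invisible at every `z`, since `|(z, μ)| ≥ μ`.
  have hbrz : ∀ z, br z μ = pairNorm z μ := fun z => hbr.eq_norm z μ hμ0 (by
    rw [pairNorm, Real.one_le_sqrt]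
    nlinarith [sq_nonneg ‖z‖])
  simp only [hbrz]
  have hI : Integrable (fun z => a z μ - ∑ j ∈ Finset.range L,
      p j z * ((pairNorm z μ ^ (d - ν - j) : ℝ) : ℂ)) := by
    refine integrable_of_norm_le_jap (C := D * √(1 + μ ^ 2) ^ (d - (ν + L))) hrt ?_ ?_
    · simpa only [hbrz] using hrem.continuous hμ0
    · intro z
      have := hD z μ hμ0
      simp only [hbrz] at this
      exact this.trans_eq (mul_right_comm _ _ _)
  rw [← integral_finsetSum _ fun i hi => hpi i hi μ hμ,
    ← integral_add (integrable_finsetSum _ fun i hi => hpi i hi μ hμ) hI]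
  exact integral_congr_ae (Eventually.of_forall fun z => by simp)

/-! ### Positively homogeneous functions and polar coordinates -/

/-- `u` is positively homogeneous of degree `t`. -/
def IsPosHomog {m : ℕ} {F : Type*} [SMul ℝ F] (t : ℝ) (u : E m → F) : Prop :=
  ∀ c : ℝ, 0 < c → ∀ z, u (c • z) = c ^ t • u z

lemma isPosHomog_norm_rpow {m : ℕ} (t : ℝ) : IsPosHomog t (fun z : E m => ‖z‖ ^ t) := by
  intro c hc z
  simp only
  rw [norm_smul, Real.norm_of_nonneg hc.le, Real.mul_rpow hc.le (norm_nonneg z), smul_eq_mul]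

/-- Dilation makes the `μ`-dependence an exact power. It is used with complex `u` for the terms and
with `u = ‖·‖ ^ t` for the error bounds. -/
lemma integral_comp_smul_smul_homog {m : ℕ} {F : Type*} [NormedAddCommGroup F] [NormedSpace ℝ F]
    {t : ℝ} {u : E m → F} (hu : IsPosHomog t u) (ψ : E m → ℝ) {μ : ℝ} (hμ : 0 < μ) :
    ∫ w, ψ (μ • w) • u w = μ ^ (-t - m) • ∫ z, ψ z • u z := by
  have h := Measure.integral_comp_smul (volume : Measure (E m)) (fun z => ψ z • u z) μ
  have h1 : ∀ w, ψ (μ • w) • u w = μ ^ (-t) • (ψ (μ • w) • u (μ • w)) := fun w => by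
    rw [hu μ hμ w, smul_comm (ψ (μ • w)) (μ ^ t), smul_smul, ← Real.rpow_add hμ, neg_add_cancel,
      Real.rpow_zero, one_smul]
  simp_rw [h1]
  rw [integral_smul, h, smul_smul, abs_of_nonneg (by positivity), sub_eq_add_neg,
    Real.rpow_add hμ, Real.rpow_neg hμ.le (m : ℝ), Real.rpow_natCast, finrank_euclideanSpace_fin]

lemma setIntegral_shell_of_isPosHomog {m : ℕ} (hm : m ≠ 0) {t R μ : ℝ} {u : E m → ℂ}
    (hu : IsPosHomog t u) (hR : 0 < R) (hRμ : R ≤ μ) :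
    ∫ z in {z : E m | ‖z‖ ∈ Ico R μ}, u z =
      (∫ φ : Metric.sphere (0 : E m) 1, u φ ∂(volume : Measure (E m)).toSphere) *
        ((∫ r in R..μ, r ^ (t + m - 1) : ℝ) : ℂ) := by
  have : NeZero m := ⟨hm⟩
  have hS : MeasurableSet {z : E m | ‖z‖ ∈ Ico R μ} := measurableSet_Ico.preimage measurable_norm
  set G : ℝ → ℂ := (Ico R μ).indicator fun r => ((r ^ t : ℝ) : ℂ) with hG
  have hrad : ∫ r : Ioi (0 : ℝ), G r ∂(Measure.volumeIoiPow (m - 1)) =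
      ((∫ r in R..μ, r ^ (t + m - 1) : ℝ) : ℂ) := by
    simp only [Measure.volumeIoiPow, ENNReal.ofReal]
    rw [integral_withDensity_eq_integral_smul ((measurable_subtype_coe.pow_const _).real_toNNReal),
      integral_subtype_comap measurableSet_Ioi fun a ↦ Real.toNNReal (a ^ (m - 1)) • G a,
      ← intervalIntegral.integral_ofReal, intervalIntegral.integral_of_le hRμ,
      ← integral_Ico_eq_integral_Ioc, ← integral_indicator measurableSet_Ioi,
      ← integral_indicator measurableSet_Ico]
    congr 1
    ext r
    by_cases hr : r ∈ Ico R μ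
    · have hr0 : 0 < r := hR.trans_le hr.1
      rw [indicator_of_mem (mem_Ioi.2 hr0), indicator_of_mem hr, hG, indicator_of_mem hr,
        NNReal.smul_def, Real.coe_toNNReal _ (by positivity), Complex.real_smul,
        ← Complex.ofReal_mul]
      congr 1
      rw [← Real.rpow_natCast, ← Real.rpow_add hr0, Nat.cast_pred (Nat.pos_of_ne_zero hm)]
      congr 1
      ring
    · rw [indicator_of_notMem hr]
      simp [hG, hr]
  calc ∫ z in {z : E m | ‖z‖ ∈ Ico R μ}, u z
      = ∫ z : E m, {z : E m | ‖z‖ ∈ Ico R μ}.indicator u z := (integral_indicator hS).symm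
    _ = ∫ x : ({(0)}ᶜ : Set (E m)), {z : E m | ‖z‖ ∈ Ico R μ}.indicator u x
          ∂((volume : Measure (E m)).comap (↑)) := by
        rw [integral_subtype_comap (measurableSet_singleton _).compl
          ({z : E m | ‖z‖ ∈ Ico R μ}.indicator u), restrict_compl_singleton]
    _ = ∫ x, u x.1 * G x.2 ∂(volume : Measure (E m)).toSphere.prod (.volumeIoiPow (m - 1)) := by
        have h := (volume : Measure (E m)).measurePreserving_homeomorphUnitSphereProd.integral_comp
          (Homeomorph.measurableEmbedding _)
          (fun x : Metric.sphere (0 : E m) 1 × Ioi (0 : ℝ) => u x.1 * G x.2)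
        rw [finrank_euclideanSpace_fin] at h
        rw [← h]
        refine integral_congr_ae (Eventually.of_forall fun x => ?_)
        have hx : 0 < ‖(x : E m)‖ := norm_pos_iff.2 x.2
        simp only [homeomorphUnitSphereProd_apply_fst_coe, homeomorphUnitSphereProd_apply_snd_coe]
        by_cases hr : ‖(x : E m)‖ ∈ Ico R μ
        · rw [indicator_of_mem (show (x : E m) ∈ {z : E m | ‖z‖ ∈ Ico R μ} from hr), hG,
            indicator_of_mem hr, hu _ (inv_pos.2 hx), Complex.real_smul, mul_right_comm,
            ← Complex.ofReal_mul, Real.inv_rpow hx.le, inv_mul_cancel₀ (by positivity)]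
          simp
        · rw [indicator_of_notMem (show (x : E m) ∉ {z : E m | ‖z‖ ∈ Ico R μ} from hr), hG,
            indicator_of_notMem hr, mul_zero]
    _ = _ := by
        rw [integral_prod_mul (fun φ : Metric.sphere (0 : E m) 1 => u φ)
          (fun r : Ioi (0 : ℝ) => G r), hrad]

/-! ### Excision functions -/

lemma IsZeroExcision.exists_one_le {m : ℕ} {χ : E m → ℝ} (hχ : IsZeroExcision χ) :
    ∃ R : ℝ, 1 ≤ R ∧ ∀ z : E m, R ≤ ‖z‖ → χ z = 1 := by
  obtain ⟨R, hR⟩ := hχ.one_far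
  exact ⟨max R 1, le_max_right _ _, fun z hz => hR z ((le_max_left _ _).trans hz)⟩

lemma IsZeroExcision.eq_zero_of_dim_zero {χ : E 0 → ℝ} (hχ : IsZeroExcision χ) (z : E 0) :
    χ z = 0 := by
  rw [Subsingleton.elim z 0]
  exact hχ.zero_near.self_of_nhds

lemma IsZeroExcision.continuous_smul {m : ℕ} {χ : E m → ℝ} (hχ : IsZeroExcision χ) {u : E m → ℂ}
    (hu : ContinuousOn u {0}ᶜ) : Continuous (fun z => χ z • u z) := by
  refine continuous_iff_continuousAt.2 fun z => ?_
  by_cases hz : z = 0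
  · subst hz
    have : (fun z => χ z • u z) =ᶠ[𝓝 0] fun _ => 0 := by
      filter_upwards [hχ.zero_near] with z hz
      rw [hz, zero_smul]
    exact continuousAt_const.congr this.symm
  · exact hχ.smooth.continuous.continuousAt.smul
      (hu.continuousAt (isOpen_compl_singleton.mem_nhds hz))

lemma IsZeroExcision.exists_norm_le {m : ℕ} {χ : E m → ℝ} (hχ : IsZeroExcision χ) :
    ∃ X : ℝ, 0 ≤ X ∧ ∀ z, |1 - χ z| ≤ X := by
  obtain ⟨R, -, hR⟩ := hχ.exists_one_le
  have hc : HasCompactSupport fun z => 1 - χ z :=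
    HasCompactSupport.intro (isCompact_closedBall (0 : E m) R) fun z hz => by
      rw [hR z (by simpa using (not_le.1 (by simpa using hz)).le), sub_self]
  obtain ⟨X, hX⟩ := hc.exists_bound_of_continuous (continuous_const.sub hχ.smooth.continuous)
  exact ⟨X, (norm_nonneg _).trans (hX 0), fun z => hX z⟩

/-- The source of the logarithm. After rescaling to the ball of radius `μ`, the part inside radius
`R` is constant, and the shell, where `χ = 1`, contributes a multiple of `∫ r ^ (t + m - 1)` over
`[R, μ]`: a logarithm if `t + m = 0`, a difference of powers otherwise. In the second case the upper
end point cancels the prefactor and gives `c`. -/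
lemma IsZeroExcision.exists_setIntegral_ball_eq {m : ℕ} {χ : E m → ℝ} (hχ : IsZeroExcision χ)
    {t : ℝ} {u : E m → ℂ} (huc : ContinuousOn u {0}ᶜ) (hu : IsPosHomog t u) :
    ∃ c α β : ℂ, (t + m ≠ 0 → α = 0) ∧ ∀ᶠ μ : ℝ in atTop,
      ∫ w in Metric.ball 0 1, χ (μ • w) • u w =
        c + (α * (Real.log μ : ℂ) + β) * ((μ ^ (-t - m) : ℝ) : ℂ) := by
  rcases eq_or_ne m 0 with rfl | hm
  · exact ⟨0, 0, 0, fun _ => rfl, by simp [hχ.eq_zero_of_dim_zero]⟩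
  obtain ⟨R, hR1, hR⟩ := hχ.exists_one_le
  have hR0 : 0 < R := by linarith
  have hcont := hχ.continuous_smul huc
  set I : ℂ := ∫ z in Metric.ball 0 R, χ z • u z with hI
  set γ : ℂ := ∫ φ : Metric.sphere (0 : E m) 1, u φ ∂(volume : Measure (E m)).toSphere with hγ
  have key : ∀ μ : ℝ, R ≤ μ → ∫ w in Metric.ball 0 1, χ (μ • w) • u w =
      ((μ ^ (-t - m) : ℝ) : ℂ) * (I + γ * ((∫ r in R..μ, r ^ (t + m - 1) : ℝ) : ℂ)) := by
    intro μ hμ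
    have hμ0 : 0 < μ := by linarith
    have h1 : ∫ w in Metric.ball 0 1, χ (μ • w) • u w =
        ∫ w, ((Metric.ball 0 μ).indicator χ (μ • w)) • u w := by
      rw [← integral_indicator Metric.isOpen_ball.measurableSet]
      congr 1
      ext w
      have : μ • w ∈ Metric.ball (0 : E m) μ ↔ w ∈ Metric.ball (0 : E m) 1 := by
        simp [norm_smul, abs_of_pos hμ0, hμ0]
      by_cases hw : w ∈ Metric.ball (0 : E m) 1
      · rw [indicator_of_mem hw, indicator_of_mem (this.2 hw)]
      · rw [indicator_of_notMem hw, indicator_of_notMem (mt this.1 hw), zero_smul]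
    have h2 : ∫ z, ((Metric.ball 0 μ).indicator χ z) • u z =
        ∫ z in Metric.ball 0 μ, χ z • u z := by
      rw [← integral_indicator Metric.isOpen_ball.measurableSet]
      congr 1
      ext w
      by_cases hw : w ∈ Metric.ball (0 : E m) μ <;> simp [indicator, hw]
    have h3 : Metric.ball (0 : E m) μ = Metric.ball 0 R ∪ {z : E m | ‖z‖ ∈ Ico R μ} := by
      ext z
      simp only [Metric.mem_ball, dist_zero_right, mem_union, mem_ofPred_eq, mem_Ico]
      constructor
      · intro h
        rcases lt_or_ge ‖z‖ R with h' | h'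
        exacts [Or.inl h', Or.inr ⟨h', h⟩]
      · rintro (h | h)
        exacts [h.trans_le hμ, h.2]
    have hS : MeasurableSet {z : E m | ‖z‖ ∈ Ico R μ} :=
      measurableSet_Ico.preimage measurable_norm
    have hint : IntegrableOn (fun z => χ z • u z) (Metric.ball 0 μ) :=
      (hcont.continuousOn.integrableOn_compact (isCompact_closedBall 0 μ)).mono_set
        Metric.ball_subset_closedBall
    rw [h1, integral_comp_smul_smul_homog hu _ hμ0, h2, Complex.real_smul, h3, setIntegral_union
      ?_ hS (hint.mono_set (h3 ▸ subset_union_left)) (hint.mono_set (h3 ▸ subset_union_right)),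
      ← setIntegral_shell_of_isPosHomog hm hu hR0 hμ]
    · congr 2
      refine setIntegral_congr_fun hS fun z hz => ?_
      simp only [hR z hz.1, one_smul]
    · refine disjoint_left.2 fun z hz hz' => ?_
      have h4 : ‖z‖ < R := by simpa using hz
      exact absurd hz'.1 (not_le.2 h4)
  by_cases hs : t + m = 0
  · refine ⟨0, γ, I - γ * (Real.log R : ℂ), fun h => absurd hs h, ?_⟩
    filter_upwards [eventually_ge_atTop R] with μ hμ
    have hμ0 : 0 < μ := by linarith
    rw [key μ hμ, hs, zero_sub]
    simp_rw [Real.rpow_neg_one]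
    rw [integral_inv_of_pos hR0 hμ0, Real.log_div hμ0.ne' hR0.ne']
    push_cast
    ring
  · refine ⟨γ / (t + m : ℝ), 0, I - γ * ((R ^ (t + m) / (t + m) : ℝ) : ℂ), fun _ => rfl, ?_⟩
    filter_upwards [eventually_ge_atTop R] with μ hμ
    have hμ0 : 0 < μ := by linarith
    have hmul : ((μ ^ (-t - m) : ℝ) : ℂ) * ((μ ^ (t + m) : ℝ) : ℂ) = 1 := by
      rw [← Complex.ofReal_mul, ← Real.rpow_add hμ0]
      simp
    rw [key μ hμ, integral_rpow (Or.inr ⟨fun h => hs (by linarith), ?_⟩), sub_add_cancel]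
    · push_cast
      linear_combination (γ / (t + m : ℂ)) * hmul
    · rw [uIcc_of_le hμ]
      exact fun h => absurd h.1 (not_le.2 hR0)

/-! ### Expansions with logarithms -/

/-- Truncated expansion `F μ = ∑_{k<K} (α k log μ + β k) μ ^ (s - k) + O((1 + log μ) μ ^ (s - K))`. -/
def HasLogExpansion (s : ℝ) (α β : ℕ → ℂ) (K : ℕ) (F : ℝ → ℂ) : Prop :=
  (fun μ : ℝ => F μ - ∑ k ∈ Finset.range K,
      (α k * (Real.log μ : ℂ) + β k) * ((μ ^ (s - k) : ℝ) : ℂ))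
    =O[atTop] fun μ : ℝ => (1 + Real.log μ) * μ ^ (s - K)

lemma isBigO_log_mul_rpow {s t : ℝ} (h : s ≤ t) :
    (fun μ : ℝ => (1 + Real.log μ) * μ ^ s) =O[atTop] fun μ : ℝ => (1 + Real.log μ) * μ ^ t :=
  (isBigO_refl _ _).mul (isBigO_rpow_rpow_atTop h)

lemma isBigO_rpow_log_mul_rpow {s t : ℝ} (h : s ≤ t) :
    (fun μ : ℝ => μ ^ s) =O[atTop] fun μ : ℝ => (1 + Real.log μ) * μ ^ t := by
  refine IsBigO.of_bound 1 ?_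
  filter_upwards [eventually_ge_atTop 1] with μ hμ
  have hl := Real.log_nonneg hμ
  rw [Real.norm_of_nonneg (by positivity), Real.norm_of_nonneg (by positivity), one_mul]
  exact (Real.rpow_le_rpow_of_exponent_le hμ h).trans
    (le_mul_of_one_le_left (by positivity) (by linarith))

lemma isBigO_log_term (α β : ℂ) (s : ℝ) :
    (fun μ : ℝ => (α * (Real.log μ : ℂ) + β) * ((μ ^ s : ℝ) : ℂ))
      =O[atTop] fun μ : ℝ => (1 + Real.log μ) * μ ^ s := by
  refine IsBigO.of_bound (‖α‖ + ‖β‖) ?_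
  filter_upwards [eventually_ge_atTop 1] with μ hμ
  have hl := Real.log_nonneg hμ
  rw [norm_mul, Complex.norm_real, Real.norm_of_nonneg (show 0 ≤ μ ^ s by positivity),
    Real.norm_of_nonneg (by positivity), ← mul_assoc]
  refine mul_le_mul_of_nonneg_right ((norm_add_le _ _).trans ?_) (by positivity)
  rw [norm_mul, Complex.norm_real, Real.norm_of_nonneg hl]
  nlinarith [norm_nonneg α, norm_nonneg β, mul_nonneg (norm_nonneg β) hl]

namespace HasLogExpansion

variable {s : ℝ} {α β : ℕ → ℂ} {K : ℕ} {F G : ℝ → ℂ}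

lemma of_add (n : ℕ) (h : HasLogExpansion s α β (K + n) F) : HasLogExpansion s α β K F := by
  induction n with
  | zero => exact h
  | succ n ih =>
    refine ih ?_
    unfold HasLogExpansion at h ⊢
    have h1 : (fun μ : ℝ => (1 + Real.log μ) * μ ^ (s - (K + (n + 1) : ℕ))) =O[atTop]
        fun μ : ℝ => (1 + Real.log μ) * μ ^ (s - (K + n : ℕ)) :=
      isBigO_log_mul_rpow (by push_cast; linarith)
    refine ((h.trans h1).add (isBigO_log_term (α (K + n)) (β (K + n)) _)).congr_left fun μ => ?_
    rw [← add_assoc, Finset.sum_range_succ]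
    ring

lemma of_le {K' : ℕ} (hK : K ≤ K') (h : HasLogExpansion s α β K' F) :
    HasLogExpansion s α β K F := by
  obtain ⟨n, rfl⟩ := Nat.exists_eq_add_of_le hK
  exact h.of_add n

lemma congr' (h : HasLogExpansion s α β K F) (hFG : F =ᶠ[atTop] G) :
    HasLogExpansion s α β K G := by
  refine IsBigO.congr' h ?_ EventuallyEq.rfl
  filter_upwards [hFG] with μ hμ
  rw [hμ]

lemma mul_rpow (h : HasLogExpansion s α β K F) (r : ℝ) :
    HasLogExpansion (s + r) α β K (fun μ => F μ * ((μ ^ r : ℝ) : ℂ)) := by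
  have h1 : (fun μ : ℝ => ((μ ^ r : ℝ) : ℂ)) =O[atTop] fun μ : ℝ => μ ^ r := by
    simpa using isBigO_const_mul_ofReal_rpow (le_refl r) 1
  refine IsBigO.congr' (IsBigO.mul h h1) ?_ ?_
  · filter_upwards [eventually_gt_atTop 0] with μ hμ
    rw [sub_mul, Finset.sum_mul]
    congr 1
    refine Finset.sum_congr rfl fun k _ => ?_
    rw [mul_assoc, ← Complex.ofReal_mul, ← Real.rpow_add hμ, sub_add_eq_add_sub]
  · filter_upwards [eventually_gt_atTop 0] with μ hμ
    rw [mul_assoc, ← Real.rpow_add hμ]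
    congr 2
    ring

end HasLogExpansion

/-! ### Shrinking excisions of functions singular at the origin. -/

lemma integrableOn_ball_norm_rpow {m : ℕ} (hm : m ≠ 0) {t : ℝ} (ht : 0 < t + m) :
    IntegrableOn (fun w : E m => ‖w‖ ^ t) (Metric.ball 0 1) := by
  have : NeZero m := ⟨hm⟩
  rw [integrableOn_fun_norm_addHaar volume (f := fun r : ℝ => r ^ t), finrank_euclideanSpace_fin]
  have h : IntegrableOn (fun r : ℝ => r ^ (t + m - 1)) (Ioo 0 1) :=
    (intervalIntegrable_iff_integrableOn_Ioo_of_le zero_le_one).1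
      (intervalIntegral.intervalIntegrable_rpow' (by linarith))
  refine h.congr_fun (fun r hr => ?_) measurableSet_Ioo
  have hr0 : 0 < r := hr.1
  simp only [smul_eq_mul]
  rw [← Real.rpow_natCast, ← Real.rpow_add hr0, Nat.cast_pred (Nat.pos_of_ne_zero hm)]
  congr 1
  ring

/-- Asymptotics of `∫ χ(μ w) g(w) dw` for `g` with an expansion in homogeneous functions at `0`. -/
theorem IsZeroExcision.exists_logExpansion {m : ℕ} {χ : E m → ℝ} (hχ : IsZeroExcision χ)
    {t : ℝ} {g : E m → ℂ} {u : ℕ → E m → ℂ} (hg : AEStronglyMeasurable g volume)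
    (hgi : IntegrableOn g (Metric.ball 0 1)ᶜ)
    (huc : ∀ k, ContinuousOn (u k) {0}ᶜ) (hu : ∀ k : ℕ, IsPosHomog (t + k) (u k))
    (hexp : ∀ K : ℕ, ∃ C : ℝ, ∀ w : E m, w ≠ 0 → ‖w‖ < 1 →
      ‖g w - ∑ k ∈ Finset.range K, u k w‖ ≤ C * ‖w‖ ^ (t + K)) :
    ∃ (c : ℂ) (α β : ℕ → ℂ), (∀ k : ℕ, t + k + m ≠ 0 → α k = 0) ∧
      ∀ K, HasLogExpansion (-t - m) α β K (fun μ => (∫ w, χ (μ • w) • g w) - c) := by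
  rcases eq_or_ne m 0 with rfl | hm
  · refine ⟨0, 0, 0, fun _ _ => rfl, fun K => ?_⟩
    simpa [HasLogExpansion, hχ.eq_zero_of_dim_zero] using isBigO_zero _ _
  have : NeZero m := ⟨hm⟩
  obtain ⟨R, hR1, hR⟩ := hχ.exists_one_le
  obtain ⟨X, hX0, hX⟩ := hχ.exists_norm_le
  have hχc := hχ.smooth.continuous
  -- From index `K₀` on, the degree `t + k` exceeds `-m`, so the terms are integrable at the origin;
  -- only the terms before it need the excision there.
  obtain ⟨K₀, hK₀⟩ : ∃ K₀ : ℕ, -(t + m) < K₀ := exists_nat_gt _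
  choose c α β hα hcαβ using fun k => hχ.exists_setIntegral_ball_eq (huc k) (hu k)
  choose C hC using hexp
  have hmeas_u : ∀ k, AEStronglyMeasurable (u k) volume := fun k => by
    have := (huc k).aestronglyMeasurable (μ := volume) (measurableSet_singleton (0 : E m)).compl
    rwa [restrict_compl_singleton] at this
  set B : Set (E m) := Metric.ball 0 1 with hB
  have hBm : MeasurableSet B := Metric.isOpen_ball.measurableSet
  have hne : ∀ᵐ w : E m, w ≠ 0 := by
    simp [ae_iff]
  -- the part of `g` which is integrable at the origin
  set ρ : E m → ℂ := fun w => g w - B.indicator (fun w => ∑ k ∈ Finset.range K₀, u k w) w with hρ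
  have hρm : AEStronglyMeasurable ρ volume :=
    hg.sub ((Finset.aestronglyMeasurable_fun_sum _ fun k _ => hmeas_u k).indicator hBm)
  have hρi : Integrable ρ volume := by
    rw [← integrableOn_univ, ← union_compl_self B]
    refine IntegrableOn.union ?_ ?_
    · refine Integrable.mono' ((integrableOn_ball_norm_rpow hm (t := t + K₀)
        (by linarith)).const_mul (C K₀)) hρm.restrict ?_
      filter_upwards [ae_restrict_mem hBm, ae_restrict_of_ae hne] with w hw hw0
      simp only [hρ, indicator_of_mem hw]
      exact hC K₀ w hw0 (by simpa [hB] using hw)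
    · refine hgi.congr_fun (fun w hw => ?_) hBm.compl
      simp only [hρ, indicator_of_notMem hw, sub_zero]
  -- Each `u k` is the difference of two consecutive remainders, so its size follows from `hC`.
  have hub : ∀ k w, w ≠ 0 → ‖w‖ < 1 → ‖u k w‖ ≤ (C k + |C (k + 1)|) * ‖w‖ ^ (t + k) := by
    intro k w hw hw1
    have hw0 : 0 < ‖w‖ := norm_pos_iff.2 hw
    have h1 := hC k w hw hw1
    have h2 := hC (k + 1) w hw hw1
    rw [Finset.sum_range_succ] at h2
    have h3 : ‖w‖ ^ (t + (k + 1 : ℕ)) ≤ ‖w‖ ^ (t + k) :=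
      Real.rpow_le_rpow_of_exponent_ge hw0 hw1.le (by push_cast; linarith)
    have h4 : u k w = (g w - ∑ i ∈ Finset.range k, u i w) -
      (g w - (∑ i ∈ Finset.range k, u i w + u k w)) := by ring
    rw [h4, add_mul]
    refine (norm_sub_le _ _).trans (add_le_add h1 (h2.trans ?_))
    exact mul_le_mul (le_abs_self _) h3 (by positivity) (abs_nonneg _)
  have hfar : ∀ μ : ℝ, R ≤ μ → ∀ w ∉ B, χ (μ • w) = 1 := fun μ hμ w hw => by
    have hw1 : 1 ≤ ‖w‖ := by simpa [hB] using hw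
    refine hR _ ?_
    rw [norm_smul, Real.norm_of_nonneg (by linarith)]
    nlinarith
  have hcut : ∀ μ : ℝ, Continuous fun w : E m => 1 - χ (μ • w) := fun μ => by fun_prop
  have hnear : ∀ μ : ℝ, R ≤ μ → ∀ s : ℝ, 0 < s + m →
      Integrable (fun w : E m => |1 - χ (μ • w)| • ‖w‖ ^ s) := by
    intro μ hμ s hs
    have h1 : IntegrableOn (fun w : E m => |1 - χ (μ • w)| • ‖w‖ ^ s) B := by
      refine Integrable.mono' ((integrableOn_ball_norm_rpow hm hs).const_mul X) ?_
        (Eventually.of_forall fun w => ?_)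
      · exact (((hcut μ).abs.aestronglyMeasurable).smul
          ((measurable_norm.pow_const s).aestronglyMeasurable)).restrict
      · rw [norm_smul, Real.norm_of_nonneg (Real.rpow_nonneg (norm_nonneg w) _), Real.norm_eq_abs,
          abs_abs]
        exact mul_le_mul_of_nonneg_right (hX _) (Real.rpow_nonneg (norm_nonneg w) _)
    refine (integrableOn_iff_integrable_of_support_subset ?_).1 h1
    intro w hw
    by_contra hwB
    exact hw (by simp [hfar μ hμ w hwB])
  have hui : ∀ k : ℕ, K₀ ≤ k → ∀ μ : ℝ, R ≤ μ →
      Integrable (fun w => (1 - χ (μ • w)) • u k w) := by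
    intro k hk μ hμ
    have hk' : (K₀ : ℝ) ≤ k := by exact_mod_cast hk
    refine Integrable.mono' ((hnear μ hμ (t + k) (by linarith)).const_mul (C k + |C (k + 1)|))
      ((hcut μ).aestronglyMeasurable.smul (hmeas_u k)) ?_
    filter_upwards [hne] with w hw
    by_cases hwB : w ∈ B
    · rw [norm_smul, Real.norm_eq_abs, smul_eq_mul]
      refine (mul_le_mul_of_nonneg_left (hub k w hw (by simpa [hB] using hwB))
        (abs_nonneg _)).trans_eq (by ring)
    · simp [hfar μ hμ w hwB]
  -- Terms with `k < K₀` are integrated over the unit ball with `χ`. For `k ≥ K₀` one starts from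
  -- the full integral of `ρ` and subtracts what `1 - χ(μ w)` removes, which scales exactly.
  set β' : ℕ → ℂ := fun k => if k < K₀ then β k else -∫ z, (1 - χ z) • u k z with hβ'
  refine ⟨(∫ w, ρ w) + ∑ k ∈ Finset.range K₀, c k, α, β', hα, fun K => ?_⟩
  -- Orders below `K₀` follow by truncation; at order at least `K₀` the remainder bound is
  -- integrable at the origin.
  refine HasLogExpansion.of_le (le_max_left K K₀) ?_
  generalize hK' : max K K₀ = K'
  have hKK : K₀ ≤ K' := hK' ▸ le_max_right _ _
  have hKK' : (K₀ : ℝ) ≤ K' := by exact_mod_cast hKK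
  set D : ℝ → E m → ℂ := fun μ w =>
    (1 - χ (μ • w)) • (g w - ∑ k ∈ Finset.range K', u k w) with hD
  have hDb : ∀ μ : ℝ, R ≤ μ → ∀ᵐ w : E m, ‖D μ w‖ ≤
      C K' * (|1 - χ (μ • w)| • ‖w‖ ^ (t + K')) := by
    intro μ hμ
    filter_upwards [hne] with w hw
    by_cases hwB : w ∈ B
    · rw [hD, norm_smul, Real.norm_eq_abs, smul_eq_mul]
      refine (mul_le_mul_of_nonneg_left (hC K' w hw (by simpa [hB] using hwB))
        (abs_nonneg _)).trans_eq (by ring)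
    · simp [hD, hfar μ hμ w hwB]
  have hDi : ∀ μ : ℝ, R ≤ μ → Integrable (D μ) := fun μ hμ =>
    Integrable.mono' ((hnear μ hμ (t + K') (by linarith)).const_mul (C K'))
      ((hcut μ).aestronglyMeasurable.smul
        (hg.sub (Finset.aestronglyMeasurable_fun_sum _ fun k _ => hmeas_u k))) (hDb μ hμ)
  have hDO : (fun μ : ℝ => -∫ w, D μ w) =O[atTop]
      fun μ : ℝ => (1 + Real.log μ) * μ ^ (-t - m - K') := by
    refine IsBigO.trans (IsBigO.neg_left (IsBigO.of_bound
      (C K' * ∫ z : E m, |1 - χ z| • ‖z‖ ^ (t + K')) ?_)) (isBigO_rpow_log_mul_rpow le_rfl)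
    filter_upwards [eventually_ge_atTop R] with μ hμ
    have hμ0 : 0 < μ := by linarith
    refine (norm_integral_le_of_norm_le ((hnear μ hμ (t + K') (by linarith)).const_mul _)
      (hDb μ hμ)).trans_eq ?_
    rw [integral_const_mul, integral_comp_smul_smul_homog (isPosHomog_norm_rpow _)
      (fun z => |1 - χ z|) hμ0, Real.norm_of_nonneg (by positivity), smul_eq_mul, mul_assoc,
      mul_comm (μ ^ _)]
    congr 3
    ring
  refine IsBigO.congr' hDO ?_ EventuallyEq.rfl
  have hev : ∀ᶠ μ : ℝ in atTop, ∀ k ∈ Finset.range K₀, ∫ w in B, χ (μ • w) • u k w =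
      c k + (α k * (Real.log μ : ℂ) + β k) * ((μ ^ (-(t + k) - m) : ℝ) : ℂ) :=
    (Finset.eventually_all _).2 fun k _ => hcαβ k
  filter_upwards [hev, eventually_ge_atTop R] with μ hev hμ
  have hμ0 : 0 < μ := by linarith
  have hχu : ∀ k, IntegrableOn (fun w => χ (μ • w) • u k w) B := fun k => by
    have h1 : (fun w => χ (μ • w) • u k w) =
        fun w => μ ^ (-(t + k)) • (χ (μ • w) • u k (μ • w)) := by
      ext1 w
      rw [hu k μ hμ0 w, smul_comm (χ (μ • w)) (μ ^ (t + (k : ℝ))), smul_smul, ← Real.rpow_add hμ0,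
        neg_add_cancel, Real.rpow_zero, one_smul]
    have h2 : Continuous (fun w => χ (μ • w) • u k w) := by
      rw [h1]
      exact ((hχ.continuous_smul (huc k)).comp (continuous_const_smul μ)).const_smul
        (μ ^ (-(t + (k : ℝ))))
    exact (h2.continuousOn.integrableOn_compact (isCompact_closedBall 0 1)).mono_set
      Metric.ball_subset_closedBall
  have hcρ : Integrable (fun w => (1 - χ (μ • w)) • ρ w) :=
    hρi.bdd_smul X (hcut μ).aestronglyMeasurable (Eventually.of_forall fun w => hX _)
  have hχρ : Integrable (fun w => χ (μ • w) • ρ w) :=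
    (hρi.sub hcρ).congr (Eventually.of_forall fun w => by
      simp only [Pi.sub_apply, sub_smul, one_smul, sub_sub_cancel])
  have e1 : ∫ w, χ (μ • w) • g w =
      (∑ k ∈ Finset.range K₀, ∫ w in B, χ (μ • w) • u k w) + ∫ w, χ (μ • w) • ρ w := by
    rw [← integral_finsetSum _ fun k _ => hχu k, ← integral_indicator hBm, ← integral_add
      ((integrable_indicator_iff hBm).2 (integrable_finsetSum _ fun k _ => hχu k)) hχρ]
    congr 1
    ext1 w
    by_cases hw : w ∈ B
    · simp only [hρ, indicator_of_mem hw, ← Finset.smul_sum, ← smul_add]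
      congr 1
      ring
    · simp only [hρ, indicator_of_notMem hw, sub_zero, zero_add]
  have e2 : ∫ w, χ (μ • w) • ρ w = (∫ w, ρ w) - ∫ w, (1 - χ (μ • w)) • ρ w := by
    rw [← integral_sub hρi hcρ]
    congr 1
    ext1 w
    rw [sub_smul, one_smul, sub_sub_cancel]
  have e3 : ∫ w, (1 - χ (μ • w)) • ρ w =
      (∑ k ∈ Finset.Ico K₀ K', ∫ w, (1 - χ (μ • w)) • u k w) + ∫ w, D μ w := by
    have hi : ∀ k ∈ Finset.Ico K₀ K', Integrable (fun w => (1 - χ (μ • w)) • u k w) :=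
      fun k hk => hui k (Finset.mem_Ico.1 hk).1 μ hμ
    rw [← integral_finsetSum _ hi, ← integral_add (integrable_finsetSum _ hi) (hDi μ hμ)]
    congr 1
    ext1 w
    by_cases hw : w ∈ B
    · simp only [hρ, hD, indicator_of_mem hw, ← Finset.smul_sum, ← smul_add]
      congr 1
      rw [← Finset.sum_range_add_sum_Ico _ hKK]
      ring
    · simp [hD, hfar μ hμ w hw]
  have hk_exp : ∀ k : ℕ, -(t + k) - m = -t - m - k := fun k => by ring
  have e4 : ∀ k, ∫ w, (1 - χ (μ • w)) • u k w =
      ((μ ^ (-t - m - k) : ℝ) : ℂ) * ∫ z, (1 - χ z) • u k z := fun k => by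
    rw [integral_comp_smul_smul_homog (hu k) (fun z => 1 - χ z) hμ0, Complex.real_smul, hk_exp]
  have e5 : ∑ k ∈ Finset.range K₀, ∫ w in B, χ (μ • w) • u k w =
      (∑ k ∈ Finset.range K₀, c k) + ∑ k ∈ Finset.range K₀,
        (α k * (Real.log μ : ℂ) + β' k) * ((μ ^ (-t - m - k) : ℝ) : ℂ) := by
    rw [← Finset.sum_add_distrib]
    refine Finset.sum_congr rfl fun k hk => ?_
    rw [hev k hk, hβ', hk_exp]
    simp only [Finset.mem_range.1 hk, if_true]
  have e6 : ∑ k ∈ Finset.Ico K₀ K', ∫ w, (1 - χ (μ • w)) • u k w =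
      -∑ k ∈ Finset.Ico K₀ K',
        (α k * (Real.log μ : ℂ) + β' k) * ((μ ^ (-t - m - k) : ℝ) : ℂ) := by
    rw [← Finset.sum_neg_distrib]
    refine Finset.sum_congr rfl fun k hk => ?_
    have hk' := (Finset.mem_Ico.1 hk).1
    have hk'' : (K₀ : ℝ) ≤ k := by exact_mod_cast hk'
    rw [e4, hα k (by
      have : 0 < t + k + m := by linarith
      exact this.ne'), hβ']
    simp only [not_lt.2 hk', if_false]
    ring
  rw [e1, e2, e3, e5, e6, ← Finset.sum_range_add_sum_Ico _ hKK]
  ring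

/-! ### Taylor expansion with parameters -/

/-- The domain `[0,1] × (ℝ^m ∖ 0)`. -/
def radialDomain (m : ℕ) : Set (ℝ × E m) := Icc 0 1 ×ˢ {0}ᶜ

lemma uniqueDiffOn_radialDomain (m : ℕ) : UniqueDiffOn ℝ (radialDomain m) :=
  (uniqueDiffOn_Icc zero_lt_one).prod isOpen_compl_singleton.uniqueDiffOn

/-- The radial derivative on `[0,1] × (ℝ^m ∖ 0)`, one-sided at the end points. -/
def radialDeriv {m : ℕ} (B : ℝ × E m → ℂ) (y : ℝ × E m) : ℂ :=
  fderivWithin ℝ B (radialDomain m) y (1, 0)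

lemma contDiffOn_radialDeriv {m : ℕ} {B : ℝ × E m → ℂ} (hB : ContDiffOn ℝ ∞ B (radialDomain m)) :
    ContDiffOn ℝ ∞ (radialDeriv B) (radialDomain m) :=
  (hB.fderivWithin (uniqueDiffOn_radialDomain m) (by simp)).clm_apply contDiffOn_const

lemma contDiffOn_iterate_radialDeriv {m : ℕ} {B : ℝ × E m → ℂ}
    (hB : ContDiffOn ℝ ∞ B (radialDomain m)) (k : ℕ) :
    ContDiffOn ℝ ∞ (radialDeriv^[k] B) (radialDomain m) := by
  induction k with
  | zero => exact hB
  | succ k ih =>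
    rw [Function.iterate_succ_apply']
    exact contDiffOn_radialDeriv ih

lemma hasDerivWithinAt_radialDeriv {m : ℕ} {B : ℝ × E m → ℂ}
    (hB : ContDiffOn ℝ ∞ B (radialDomain m)) {w : E m} (hw : w ≠ 0) {ρ : ℝ}
    (hρ : ρ ∈ Icc (0 : ℝ) 1) :
    HasDerivWithinAt (fun r => B (r, w)) (radialDeriv B (ρ, w)) (Icc 0 1) ρ := by
  have h1 : HasFDerivWithinAt B (fderivWithin ℝ B (radialDomain m) (ρ, w)) (radialDomain m)
      (ρ, w) := (hB.differentiableOn (by simp) (ρ, w) ⟨hρ, hw⟩).hasFDerivWithinAt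
  have h2 : HasDerivWithinAt (fun r : ℝ => (r, w)) (1, 0) (Icc 0 1) ρ :=
    ((hasDerivAt_id ρ).prodMk (hasDerivAt_const ρ w)).hasDerivWithinAt
  have h3 : MapsTo (fun r : ℝ => (r, w)) (Icc 0 1) (radialDomain m) := fun r hr => ⟨hr, hw⟩
  exact h1.comp_hasDerivWithinAt ρ h2 h3

/-- One-variable Taylor coefficients become restrictions of jointly smooth functions, which gives
their continuity in `w` and bounds uniform on the sphere. -/
lemma iteratedDerivWithin_eq_iterate_radialDeriv {m : ℕ} {B : ℝ × E m → ℂ}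
    (hB : ContDiffOn ℝ ∞ B (radialDomain m)) {w : E m} (hw : w ≠ 0) (k : ℕ) {ρ : ℝ}
    (hρ : ρ ∈ Icc (0 : ℝ) 1) :
    iteratedDerivWithin k (fun r => B (r, w)) (Icc 0 1) ρ = radialDeriv^[k] B (ρ, w) := by
  induction k generalizing ρ with
  | zero => simp
  | succ k ih =>
    rw [iteratedDerivWithin_succ, derivWithin_congr (fun r hr => ih hr) (ih hρ),
      Function.iterate_succ_apply']
    exact (hasDerivWithinAt_radialDeriv (contDiffOn_iterate_radialDeriv hB k) hw hρ).derivWithin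
      (uniqueDiffOn_Icc zero_lt_one ρ hρ)

/-- Compactness of `[0,1] × 𝕊^(m-1)` makes the Taylor remainder uniform for unit `w`; invariance
under dilation of `w` carries the bound to all `w ≠ 0`. -/
lemma exists_radial_taylor {m : ℕ} {B : ℝ → E m → ℂ}
    (hB : ContDiffOn ℝ ∞ (fun y : ℝ × E m => B y.1 y.2) (radialDomain m))
    (hhom : ∀ c : ℝ, 0 < c → ∀ ρ w, B ρ (c • w) = B ρ w) :
    ∃ G : ℕ → E m → ℂ, (∀ k, ContinuousOn (G k) {0}ᶜ) ∧
      (∀ k, ∀ c : ℝ, 0 < c → ∀ w, G k (c • w) = G k w) ∧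
      ∀ K : ℕ, ∃ C : ℝ, ∀ w : E m, w ≠ 0 → ∀ ρ ∈ Icc (0 : ℝ) 1,
        ‖B ρ w - ∑ k ∈ Finset.range K, ρ ^ k • G k w‖ ≤ C * ρ ^ K := by
  set G : ℕ → E m → ℂ := fun k w =>
    (k.factorial : ℝ)⁻¹ • iteratedDerivWithin k (fun r => B r w) (Icc 0 1) 0 with hG
  have hGhom : ∀ k, ∀ c : ℝ, 0 < c → ∀ w, G k (c • w) = G k w := fun k c hc w => by
    simp only [hG, hhom c hc]
  have hbound : ∀ k : ℕ, ∃ C : ℝ, ∀ w : E m, ‖w‖ = 1 → ∀ ρ ∈ Icc (0 : ℝ) 1,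
      ‖iteratedDerivWithin k (fun r => B r w) (Icc 0 1) ρ‖ ≤ C := fun k => by
    have hsub : Icc (0 : ℝ) 1 ×ˢ Metric.sphere (0 : E m) 1 ⊆ radialDomain m :=
      prod_mono_right fun w hw => by
        rintro rfl
        simp at hw
    obtain ⟨C, hC⟩ := (isCompact_Icc.prod (isCompact_sphere (0 : E m) 1)).exists_bound_of_continuousOn
      ((contDiffOn_iterate_radialDeriv hB k).continuousOn.mono hsub)
    refine ⟨C, fun w hw ρ hρ => ?_⟩
    have hw0 : w ≠ 0 := by
      rintro rfl
      simp at hw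
    rw [iteratedDerivWithin_eq_iterate_radialDeriv hB hw0 k hρ]
    exact hC (ρ, w) ⟨hρ, by simpa using hw⟩
  refine ⟨G, fun k => ?_, hGhom, fun K => ?_⟩
  · have h1 : ContinuousOn (fun w : E m => radialDeriv^[k] (fun y => B y.1 y.2) (0, w)) {0}ᶜ :=
      (contDiffOn_iterate_radialDeriv hB k).continuousOn.comp (by fun_prop)
        fun w hw => ⟨by simp, hw⟩
    refine (h1.const_smul ((k.factorial : ℝ)⁻¹)).congr fun w hw => ?_
    simp only [hG]
    rw [iteratedDerivWithin_eq_iterate_radialDeriv hB hw k (by simp)]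
    rfl
  · obtain ⟨C, hC⟩ := hbound K
    have hunit : ∀ w : E m, ‖w‖ = 1 → ∀ ρ ∈ Icc (0 : ℝ) 1,
        ‖B ρ w - ∑ k ∈ Finset.range K, ρ ^ k • G k w‖ ≤ |C| * ρ ^ K := by
      intro w hw ρ hρ
      rcases K with _ | n
      · have := hC w hw ρ hρ
        simp only [iteratedDerivWithin_zero] at this
        simpa using this.trans (le_abs_self C)
      · have hw0 : w ≠ 0 := by
          rintro rfl
          simp at hw
        have hsm : ContDiffOn ℝ (n + 1) (fun r => B r w) (Icc 0 1) := by
          have h1 : ContDiffOn ℝ ∞ (fun r => B r w) (Icc 0 1) :=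
            hB.comp (f := fun r : ℝ => (r, w)) (by fun_prop) fun r hr => ⟨hr, hw0⟩
          exact h1.of_le (by exact_mod_cast le_top)
        have h := taylor_mean_remainder_bound zero_le_one hsm hρ (hC w hw)
        rw [taylor_within_apply] at h
        have hEq : ∑ k ∈ Finset.range (n + 1), ((k.factorial : ℝ)⁻¹ * (ρ - 0) ^ k) •
            iteratedDerivWithin k (fun r => B r w) (Icc 0 1) 0
            = ∑ k ∈ Finset.range (n + 1), ρ ^ k • G k w :=
          Finset.sum_congr rfl fun k _ => by
            simp only [hG, sub_zero, smul_smul]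
            rw [mul_comm]
        rw [hEq, sub_zero] at h
        refine h.trans ?_
        have hρ0 := hρ.1
        have hn : (1 : ℝ) ≤ n.factorial := by exact_mod_cast n.factorial_pos
        calc C * ρ ^ (n + 1) / n.factorial ≤ |C| * ρ ^ (n + 1) / n.factorial := by
              gcongr
              exact le_abs_self C
          _ ≤ |C| * ρ ^ (n + 1) := div_le_self (by positivity) hn
    refine ⟨|C|, fun w hw ρ hρ => ?_⟩
    have hw0 : 0 < ‖w‖ := norm_pos_iff.2 hw
    have h := hunit (‖w‖⁻¹ • w) (by rw [norm_smul, norm_inv, norm_norm, inv_mul_cancel₀ hw0.ne'])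
      ρ hρ
    simpa only [hhom _ (inv_pos.2 hw0), hGhom _ _ (inv_pos.2 hw0)] using h

/-! ### Homogeneous symbols -/

lemma pairNorm_smul {m : ℕ} (w : E m) {μ : ℝ} (hμ : 0 < μ) :
    pairNorm (μ • w) μ = μ * pairNorm w 1 := by
  have : ‖μ • w‖ ^ 2 + μ ^ 2 = μ ^ 2 * (‖w‖ ^ 2 + 1 ^ 2) := by
    rw [norm_smul, Real.norm_of_nonneg hμ.le]; ring
  rw [pairNorm, this, Real.sqrt_mul (by positivity), Real.sqrt_sq hμ.le, pairNorm]

lemma IsHomSymbol.apply_smul {m : ℕ} {d ν : ℝ} {A : E m → ℝ → ℂ} (hA : IsHomSymbol d ν A)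
    {w : E m} (hw : w ≠ 0) {μ : ℝ} (hμ : 0 < μ) : A (μ • w) μ = μ ^ d • A w 1 := by
  obtain ⟨h, -, hA⟩ := hA
  have hp : 0 < pairNorm w 1 := by unfold pairNorm; positivity
  rw [hA _ _ (smul_ne_zero hμ.ne' hw) hμ.le, hA w 1 hw zero_le_one, pairNorm_smul w hμ,
    Real.mul_rpow hμ.le hp.le, Complex.real_smul, ← mul_assoc, ← Complex.ofReal_mul, smul_smul]
  congr 2
  · rw [mul_inv, mul_right_comm, inv_mul_cancel₀ hμ.ne', one_mul]
  · field_simp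

/-- The profile of a homogeneous symbol on `μ = 1`, up to the factor `‖w‖ ^ ν`, in the variables
`ρ = ‖w‖` and `w`. -/
def homProfile {m : ℕ} (e : ℝ) (b : ℝ → E m → ℂ) (ρ : ℝ) (w : E m) : ℂ :=
  √(1 + ρ ^ 2) ^ e • b (ρ / √(1 + ρ ^ 2)) (‖w‖⁻¹ • w)

lemma contDiffOn_homProfile {m : ℕ} (e : ℝ) {b : ℝ → E m → ℂ}
    (hb : ContDiffOn ℝ ∞ (fun y : ℝ × E m => b y.1 y.2) (Ico 0 1 ×ˢ Metric.sphere 0 1)) :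
    ContDiffOn ℝ ∞ (fun y : ℝ × E m => homProfile e b y.1 y.2) (Ici 0 ×ˢ {0}ᶜ) := by
  have hs : ContDiff ℝ ∞ fun y : ℝ × E m => √(1 + y.1 ^ 2) :=
    ContDiff.sqrt (by fun_prop) fun y => by positivity
  have hs0 : ∀ y : ℝ × E m, √(1 + y.1 ^ 2) ≠ 0 := fun y => by positivity
  have h1 : ContDiff ℝ ∞ fun y : ℝ × E m => √(1 + y.1 ^ 2) ^ e :=
    hs.rpow_const_of_ne hs0
  have h2 : ContDiffOn ℝ ∞ (fun y : ℝ × E m => (y.1 / √(1 + y.1 ^ 2), ‖y.2‖⁻¹ • y.2))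
      (Ici 0 ×ˢ {0}ᶜ) := by
    have h3 : ContDiffOn ℝ ∞ (fun y : ℝ × E m => ‖y.2‖⁻¹) (Ici 0 ×ˢ {0}ᶜ) :=
      ContDiffOn.inv (contDiffOn_snd.norm ℝ fun y hy => hy.2) fun y hy => norm_ne_zero_iff.2 hy.2
    exact (contDiff_fst.div hs hs0).contDiffOn.prodMk (h3.smul contDiffOn_snd)
  refine h1.contDiffOn.smul (hb.comp h2 fun y hy => ⟨⟨?_, ?_⟩, ?_⟩)
  · exact div_nonneg hy.1 (Real.sqrt_nonneg _)
  · rw [div_lt_one (by positivity)]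
    exact Real.lt_sqrt_of_sq_lt (by linarith)
  · have : 0 < ‖y.2‖ := norm_pos_iff.2 hy.2
    simp [norm_smul, this.ne']

lemma homProfile_smul {m : ℕ} (e : ℝ) (b : ℝ → E m → ℂ) {c : ℝ} (hc : 0 < c) (ρ : ℝ) (w : E m) :
    homProfile e b ρ (c • w) = homProfile e b ρ w := by
  have : ‖c • w‖⁻¹ • c • w = ‖w‖⁻¹ • w := by
    rw [norm_smul, Real.norm_of_nonneg hc.le, smul_smul, mul_inv, mul_right_comm,
      inv_mul_cancel₀ hc.ne', one_mul]
  rw [homProfile, this, homProfile]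

/-- With `S = √(1 + ‖w‖²)`, the point `(w, 1)/S` has radial coordinate `r = ‖w‖/S` and height `1/S`.
Hence `S^d r^ν = ‖w‖^ν S^(d-ν)`, leaving the smooth factor `b`. -/
lemma IsHomSymbol.exists_profile {m : ℕ} {d ν : ℝ} {A : E m → ℝ → ℂ} (hA : IsHomSymbol d ν A) :
    ∃ b : ℝ → E m → ℂ,
      ContDiffOn ℝ ∞ (fun y : ℝ × E m => b y.1 y.2) (Ico 0 1 ×ˢ Metric.sphere 0 1) ∧
      ∀ w : E m, w ≠ 0 → A w 1 = ‖w‖ ^ ν • homProfile (d - ν) b ‖w‖ w := by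
  obtain ⟨h, ⟨-, b, hb, hbh⟩, hA⟩ := hA
  refine ⟨b, hb, fun w hw => ?_⟩
  have hw0 : 0 < ‖w‖ := norm_pos_iff.2 hw
  have hp : pairNorm w 1 = √(1 + ‖w‖ ^ 2) := by rw [pairNorm, one_pow, add_comm]
  set S : ℝ := √(1 + ‖w‖ ^ 2) with hS
  have hS0 : 0 < S := by positivity
  have hS2 : S ^ 2 = 1 + ‖w‖ ^ 2 := Real.sq_sqrt (by positivity)
  have hr : ‖w‖ / S ∈ Ioo (0 : ℝ) 1 := by
    refine ⟨by positivity, ?_⟩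
    rw [div_lt_one hS0]
    exact Real.lt_sqrt_of_sq_lt (by linarith)
  have hφ : ‖w‖⁻¹ • w ∈ Metric.sphere (0 : E m) 1 := by simp [norm_smul, hw0.ne']
  have e1 : (‖w‖ / S) • ‖w‖⁻¹ • w = S⁻¹ • w := by
    rw [smul_smul]
    congr 1
    field_simp
  have e2 : √(1 - (‖w‖ / S) ^ 2) = S⁻¹ := by
    have : 1 - (‖w‖ / S) ^ 2 = (S⁻¹) ^ 2 := by
      field_simp
      linarith
    rw [this, Real.sqrt_sq (by positivity)]
  have e3 := hbh _ hr _ hφ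
  rw [e1, e2] at e3
  rw [hA w 1 hw zero_le_one, hp, mul_one, homProfile, ← hS, e3, Complex.real_smul,
    Complex.real_smul, ← mul_assoc, ← mul_assoc, ← Complex.ofReal_mul, ← Complex.ofReal_mul]
  congr 2
  rw [Real.div_rpow hw0.le hS0.le, Real.rpow_neg hw0.le, Real.rpow_neg hS0.le, Real.rpow_sub hS0]
  have := Real.rpow_pos_of_pos hw0 ν
  have := Real.rpow_pos_of_pos hS0 ν
  field_simp

/-- Asymptotics of the integral of an excised homogeneous symbol. -/
theorem IsHomSymbol.exists_logExpansion {m : ℕ} {d ν : ℝ} {A : E m → ℝ → ℂ}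
    (hA : IsHomSymbol d ν A) {χ : E m → ℝ} (hχ : IsZeroExcision χ)
    (hint : ∀ μ : ℝ, 0 ≤ μ → Integrable (fun z => (χ z : ℂ) * A z μ) volume) :
    ∃ (c : ℂ) (α β : ℕ → ℂ), (∀ k : ℕ, ν + k + m ≠ 0 → α k = 0) ∧
      ∀ K, HasLogExpansion (d - ν) α β K
        (fun μ => (∫ z, (χ z : ℂ) * A z μ) - c * ((μ ^ (d + m) : ℝ) : ℂ)) := by
  rcases eq_or_ne m 0 with rfl | hm
  · refine ⟨0, 0, 0, fun _ _ => rfl, fun K => ?_⟩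
    simpa [HasLogExpansion, hχ.eq_zero_of_dim_zero] using isBigO_zero _ _
  have : NeZero m := ⟨hm⟩
  obtain ⟨b, hb, hAb⟩ := hA.exists_profile
  have hBs := contDiffOn_homProfile (d - ν) hb
  have hdom : radialDomain m ⊆ Ici 0 ×ˢ {0}ᶜ := prod_mono_left Icc_subset_Ici_self
  obtain ⟨G, hGc, hGh, hGt⟩ := exists_radial_taylor (hBs.mono hdom)
    (fun c hc ρ w => homProfile_smul (d - ν) b hc ρ w)
  obtain ⟨R, hR1, hR⟩ := hχ.exists_one_le
  have hscale : ∀ μ : ℝ, 0 < μ → ∀ w : E m,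
      (χ (μ • w) : ℂ) * A (μ • w) μ = μ ^ d • (χ (μ • w) • A w 1) := by
    intro μ hμ w
    by_cases hw : w = 0
    · have : χ (μ • w) = 0 := by rw [hw, smul_zero]; exact hχ.zero_near.self_of_nhds
      simp [this]
    · rw [hA.apply_smul hw hμ, ← Complex.real_smul, smul_comm]
  have hpow : ∀ t : ℝ, ContinuousOn (fun w : E m => ‖w‖ ^ t) {0}ᶜ := fun t =>
    continuous_norm.continuousOn.rpow_const fun w hw => Or.inl (norm_ne_zero_iff.2 hw)
  have hg : AEStronglyMeasurable (fun w => A w 1) volume := by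
    have h1 : ContinuousOn (fun w : E m => ‖w‖ ^ ν • homProfile (d - ν) b ‖w‖ w) {0}ᶜ :=
      (hpow ν).smul (hBs.continuousOn.comp (f := fun w : E m => (‖w‖, w)) (by fun_prop)
        fun w hw => ⟨norm_nonneg w, hw⟩)
    have h2 : ContinuousOn (fun w : E m => A w 1) {0}ᶜ := h1.congr fun w hw => hAb w hw
    have := h2.aestronglyMeasurable (μ := volume) (measurableSet_singleton (0 : E m)).compl
    rwa [restrict_compl_singleton] at this
  -- Decay at infinity is read off from the integrable function at `μ = R`: after rescaling by `R`,
  -- the excision equals `1` outside the unit ball.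
  have hgi : IntegrableOn (fun w => A w 1) (Metric.ball 0 1)ᶜ := by
    have hR0 : 0 < R := by linarith
    have h1 := ((hint R hR0.le).comp_smul hR0.ne').smul (R ^ (-d))
    refine (h1.integrableOn (s := (Metric.ball 0 1)ᶜ)).congr_fun (fun w hw => ?_)
      Metric.isOpen_ball.measurableSet.compl
    have hw1 : 1 ≤ ‖w‖ := by simpa using hw
    have hχ1 : χ (R • w) = 1 := hR _ (by
      rw [norm_smul, Real.norm_of_nonneg hR0.le]
      nlinarith)
    simp only [Pi.smul_apply]
    rw [hscale R hR0, hχ1, one_smul, smul_smul, ← Real.rpow_add hR0, neg_add_cancel,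
      Real.rpow_zero, one_smul]
  obtain ⟨c, α, β, hα, hexp⟩ := hχ.exists_logExpansion (t := ν) hg hgi
    (u := fun k w => ‖w‖ ^ (ν + k) • G k w) (fun k => (hpow _).smul (hGc k))
    (fun k a ha w => by
      simp only
      rw [hGh k a ha w, show ‖a • w‖ ^ (ν + k) = a ^ (ν + k) • ‖w‖ ^ (ν + k) from
        isPosHomog_norm_rpow (ν + k) a ha w, smul_assoc])
    (fun K => by
      obtain ⟨C, hC⟩ := hGt K
      refine ⟨C, fun w hw hw1 => ?_⟩
      have hw0 : 0 < ‖w‖ := norm_pos_iff.2 hw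
      have h1 : A w 1 - ∑ k ∈ Finset.range K, ‖w‖ ^ (ν + k) • G k w =
          ‖w‖ ^ ν • (homProfile (d - ν) b ‖w‖ w - ∑ k ∈ Finset.range K, ‖w‖ ^ k • G k w) := by
        rw [hAb w hw, smul_sub, Finset.smul_sum]
        congr 1
        refine Finset.sum_congr rfl fun k _ => ?_
        rw [Real.rpow_add hw0, Real.rpow_natCast, smul_smul]
      rw [h1, norm_smul, Real.norm_of_nonneg (by positivity), Real.rpow_add hw0,
        Real.rpow_natCast, mul_left_comm]
      exact mul_le_mul_of_nonneg_left (hC w hw ‖w‖ ⟨hw0.le, hw1.le⟩) (by positivity))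
  refine ⟨c, α, β, hα, fun K => ?_⟩
  have h := (hexp K).mul_rpow (d + m)
  have hs : -ν - (m : ℝ) + (d + m) = d - ν := by ring
  rw [hs] at h
  refine h.congr' ?_
  filter_upwards [eventually_gt_atTop 0] with μ hμ
  have h1 := Measure.integral_comp_smul (volume : Measure (E m)) (fun z => (χ z : ℂ) * A z μ) μ
  simp_rw [hscale μ hμ] at h1
  rw [integral_smul, finrank_euclideanSpace_fin, abs_of_nonneg (by positivity)] at h1
  have h2 : ∫ z, (χ z : ℂ) * A z μ = μ ^ (d + m) • ∫ w, χ (μ • w) • A w 1 := by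
    rw [Real.rpow_add hμ, mul_comm, mul_smul, h1, smul_smul, Real.rpow_natCast,
      mul_inv_cancel₀ (by positivity), one_smul]
  rw [h2, Complex.real_smul]
  ring

/-! ### Uniqueness of coefficients -/

lemma eq_zero_of_const_mul_rpow_isLittleO {s : ℝ} {c : ℂ}
    (h : (fun μ : ℝ => c * ((μ ^ s : ℝ) : ℂ)) =o[atTop] fun μ : ℝ => μ ^ s) : c = 0 := by
  by_contra hc
  have h1 : (fun μ : ℝ => μ ^ s) =o[atTop] fun μ : ℝ => μ ^ s := by
    have := ((isLittleO_const_mul_left_iff hc).1 h).norm_left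
    simp only [Complex.norm_real] at this
    exact this.of_norm_left
  refine isLittleO_irrefl (Eventually.frequently ?_) h1
  filter_upwards [eventually_gt_atTop 0] with μ hμ
  exact (Real.rpow_pos_of_pos hμ s).ne'

lemma isLittleO_log_mul_rpow {s t : ℝ} (h : s < t) :
    (fun μ : ℝ => (1 + Real.log μ) * μ ^ s) =o[atTop] fun μ : ℝ => μ ^ t := by
  have h1 : (fun μ : ℝ => 1 + Real.log μ) =o[atTop] fun μ : ℝ => μ ^ (t - s) := by
    refine IsLittleO.add ?_ (isLittleO_log_rpow_atTop (sub_pos.2 h))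
    refine (isLittleO_const_left.2 (Or.inr ?_))
    exact tendsto_norm_atTop_atTop.comp (tendsto_rpow_atTop (sub_pos.2 h))
  refine (h1.mul_isBigO (isBigO_refl (fun μ : ℝ => μ ^ s) atTop)).congr' EventuallyEq.rfl ?_
  filter_upwards [eventually_gt_atTop 0] with μ hμ
  rw [← Real.rpow_add hμ, sub_add_cancel]

/-- Dropping the last term weakens the error by one order, so induction kills all earlier
coefficients and then the last one stands alone. -/
lemma eq_zero_of_sum_rpow_isLittleO {s : ℝ} {z : ℕ → ℂ} {n : ℕ}
    (h : (fun μ : ℝ => ∑ i ∈ Finset.range (n + 1), z i * ((μ ^ (s - i) : ℝ) : ℂ))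
      =o[atTop] fun μ : ℝ => μ ^ (s - n)) : ∀ i ≤ n, z i = 0 := by
  induction n with
  | zero =>
    intro i hi
    obtain rfl : i = 0 := by omega
    exact eq_zero_of_const_mul_rpow_isLittleO (by simpa using h)
  | succ n ih =>
    have h1 : (fun μ : ℝ => μ ^ (s - (n + 1 : ℕ))) =o[atTop] fun μ : ℝ => μ ^ (s - n) :=
      (isBigO_rpow_log_mul_rpow le_rfl).trans_isLittleO
        (isLittleO_log_mul_rpow (by push_cast; linarith))
    have h2 := ih (((h.trans h1).sub ((isBigO_const_mul_ofReal_rpow le_rfl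
      (z (n + 1))).trans_isLittleO h1)).congr_left fun μ => by
        rw [Finset.sum_range_succ _ (n + 1)]
        ring)
    intro i hi
    rcases Nat.lt_or_eq_of_le hi with hi | rfl
    · exact h2 i (by omega)
    · refine eq_zero_of_const_mul_rpow_isLittleO (h.congr_left fun μ => ?_)
      rw [Finset.sum_range_succ, Finset.sum_eq_zero, zero_add]
      intro j hj
      rw [h2 j (Nat.lt_succ_iff.1 (Finset.mem_range.1 hj)), zero_mul]

namespace HasLogExpansion

variable {s : ℝ} {α β : ℕ → ℂ} {K : ℕ} {F G : ℝ → ℂ}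

lemma unique {x y : ℕ → ℂ} (hx : HasLogExpansion s α x K F) (hy : HasLogExpansion s α y K F)
    {i : ℕ} (hi : i < K) : x i = y i := by
  -- The logarithmic parts agree and cancel. The error `(1 + log μ) μ ^ (s - n - 1)` is `o(μ ^ (s -
  -- n))`, just enough to compare the coefficients up to `n`.
  obtain ⟨n, rfl⟩ : ∃ n, K = n + 1 := ⟨K - 1, by omega⟩
  have h : (fun μ : ℝ => ∑ i ∈ Finset.range (n + 1), (x i - y i) * ((μ ^ (s - i) : ℝ) : ℂ))
      =o[atTop] fun μ : ℝ => μ ^ (s - n) := by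
    refine (IsBigO.trans_isLittleO (IsBigO.sub hy hx)
      (isLittleO_log_mul_rpow (by push_cast; linarith))).congr_left fun μ => ?_
    rw [sub_sub_sub_cancel_left, ← Finset.sum_sub_distrib]
    exact Finset.sum_congr rfl fun k _ => by ring
  exact sub_eq_zero.1 (eq_zero_of_sum_rpow_isLittleO h i (by omega))

lemma congr_coeff {α' β' : ℕ → ℂ} (h : HasLogExpansion s α β K F) (hα : ∀ k < K, α k = α' k)
    (hβ : ∀ k < K, β k = β' k) : HasLogExpansion s α' β' K F := by
  refine IsBigO.congr_left h fun μ => ?_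
  congr 1
  refine Finset.sum_congr rfl fun k hk => ?_
  rw [hα k (Finset.mem_range.1 hk), hβ k (Finset.mem_range.1 hk)]

lemma add {α' β' : ℕ → ℂ} (hF : HasLogExpansion s α β K F) (hG : HasLogExpansion s α' β' K G) :
    HasLogExpansion s (α + α') (β + β') K (fun μ => F μ + G μ) := by
  refine (IsBigO.add hF hG).congr_left fun μ => ?_
  simp only [Pi.add_apply]
  rw [← add_sub_add_comm, ← Finset.sum_add_distrib]
  congr 1
  exact Finset.sum_congr rfl fun k _ => by ring

lemma sum {α β : ℕ → ℕ → ℂ} {F : ℕ → ℝ → ℂ} (h : ∀ j, HasLogExpansion s (α j) (β j) K (F j))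
    (N : ℕ) : HasLogExpansion s (fun k => ∑ j ∈ Finset.range N, α j k)
      (fun k => ∑ j ∈ Finset.range N, β j k) K (fun μ => ∑ j ∈ Finset.range N, F j μ) := by
  induction N with
  | zero => simpa [HasLogExpansion] using isBigO_zero _ _
  | succ N ih =>
    simp only [Finset.sum_range_succ]
    exact ih.add (h N)

lemma add_isBigO (hF : HasLogExpansion s α β K F) (hG : G =O[atTop] fun μ : ℝ => μ ^ (s - K)) :
    HasLogExpansion s α β K (fun μ => F μ + G μ) :=
  (IsBigO.add hF (hG.trans (isBigO_rpow_log_mul_rpow le_rfl))).congr_left fun μ => by ring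

end HasLogExpansion

lemma isBigO_sum_Ico_rpow (c : ℕ → ℂ) (e : ℝ) (M N : ℕ) :
    (fun μ : ℝ => ∑ j ∈ Finset.Ico M N, c j * ((μ ^ (e - j) : ℝ) : ℂ))
      =O[atTop] fun μ : ℝ => μ ^ (e - M) :=
  IsBigO.fun_sum fun j hj => isBigO_const_mul_ofReal_rpow (by
    have : (M : ℝ) ≤ j := by exact_mod_cast (Finset.mem_Ico.1 hj).1
    linarith) _

/-- Coefficients depending on the truncation can be replaced by coefficients that do not. -/
lemma exists_common_coefficients {F : ℝ → ℂ} {e s : ℝ} {c c' : ℕ → ℂ}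
    (h : ∀ L : ℕ, ∃ N₀ : ℕ, ∀ N ≥ N₀, ∃ x : ℕ → ℂ, HasLogExpansion s c' x L
      (fun μ => F μ - ∑ j ∈ Finset.range N, c j * ((μ ^ (e - j) : ℝ) : ℂ))) :
    ∃ c'' : ℕ → ℂ, ∀ L : ℕ, ∃ N₀ : ℕ, ∀ N ≥ N₀, HasLogExpansion s c' c'' L
      (fun μ => F μ - ∑ j ∈ Finset.range N, c j * ((μ ^ (e - j) : ℝ) : ℂ)) := by
  have h1 : ∀ L : ℕ, ∃ N₀ : ℕ, ∃ x : ℕ → ℂ, ∀ N ≥ N₀, HasLogExpansion s c' x L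
      (fun μ => F μ - ∑ j ∈ Finset.range N, c j * ((μ ^ (e - j) : ℝ) : ℂ)) := by
    intro L
    obtain ⟨N₀, hN₀⟩ := h L
    -- Powers `μ ^ (e - j)` with `j ≥ N₁` are already `O(μ ^ (s - L))`, so one `x` works for all
    -- larger `N`.
    obtain ⟨N₁, hN₁⟩ := exists_nat_ge (e - s + L)
    obtain ⟨x, hx⟩ := hN₀ (max N₀ N₁) (le_max_left _ _)
    refine ⟨max N₀ N₁, x, fun N hN => ?_⟩
    have hM : (N₁ : ℝ) ≤ (max N₀ N₁ : ℕ) := by exact_mod_cast le_max_right _ _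
    refine (hx.add_isBigO (((isBigO_sum_Ico_rpow c e (max N₀ N₁) N).trans
      (isBigO_rpow_rpow_atTop (by linarith))).neg_left)).congr' (Eventually.of_forall fun μ => ?_)
    simp only
    rw [← Finset.sum_range_add_sum_Ico _ hN]
    ring
  choose N₀ x hx using h1
  -- Order `l + 1` is the lowest that determines coefficient `l`; higher orders agree with it by
  -- `unique`.
  refine ⟨fun l => x (l + 1) l, fun L => ⟨N₀ L, fun N hN => (hx L N hN).congr_coeff
    (fun _ _ => rfl) fun l hl => ?_⟩⟩
  have hN' := hx L (max N (N₀ (l + 1))) (hN.trans (le_max_left _ _))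
  exact (hN'.of_le (show l + 1 ≤ L from hl)).unique (hx (l + 1) _ (le_max_right _ _))
    (Nat.lt_succ_self l)

/-! ### Poly-homogeneous symbols -/

/-- The integral of a poly-homogeneous symbol has, up to any order, an expansion whose
pure power coefficients may depend on the order. -/
lemma IsPolyhomSymbol.exists_truncated_expansion {m : ℕ} {d ν : ℝ} (hd : d < -(m : ℝ))
    {a : E m → ℝ → ℂ} (ha : IsPolyhomSymbol d ν a) :
    ∃ c c' : ℕ → ℂ, ∀ L : ℕ, ∃ N₀ : ℕ, ∀ N ≥ N₀, ∃ x : ℕ → ℂ, HasLogExpansion (d - ν) c' x L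
      (fun μ => (∫ z, a z μ) - ∑ j ∈ Finset.range N, c j * ((μ ^ (d + m - j) : ℝ) : ℂ)) := by
  obtain ⟨-, χ, hχ, A, hA, hr⟩ := ha
  have hri : ∀ N : ℕ, ∀ μ : ℝ, 0 ≤ μ → Integrable (fun z =>
      a z μ - (χ z : ℂ) * ∑ j ∈ Finset.range N, A j z μ) := fun N μ hμ =>
    (hr N).1.integrable (by
      have : (0 : ℝ) ≤ N := by positivity
      linarith) hμ
  -- The excised component is the difference of two consecutive remainders, both of order at most `d
  -- < -m`.
  have hAi : ∀ j : ℕ, ∀ μ : ℝ, 0 ≤ μ → Integrable (fun z => (χ z : ℂ) * A j z μ) :=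
    fun j μ hμ => ((hri j μ hμ).sub (hri (j + 1) μ hμ)).congr (Eventually.of_forall fun z => by
      simp only [Pi.sub_apply, Finset.sum_range_succ]
      ring)
  have hj : ∀ j : ℕ, ∃ (c : ℂ) (α β : ℕ → ℂ), (∀ k : ℕ, ν - j + k + m ≠ 0 → α k = 0) ∧
      ∀ K, HasLogExpansion (d - ν) α β K
        (fun μ => (∫ z, (χ z : ℂ) * A j z μ) - c * ((μ ^ (d + m - j) : ℝ) : ℂ)) := fun j => by
    have h := (hA j).exists_logExpansion hχ (hAi j)
    rwa [sub_sub_sub_cancel_right, sub_add_eq_add_sub] at h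
  choose c α β hα hexp using hj
  -- Past this index `ν - j + l + m` is negative, so no further component contributes a logarithm at
  -- order `l`.
  set J : ℕ → ℕ := fun l => ⌈ν + m + l⌉₊ + 1 with hJ
  have hα0 : ∀ l j : ℕ, J l ≤ j → α j l = 0 := fun l j hj => hα j l (by
    have h1 : ν + m + l ≤ ⌈ν + m + l⌉₊ := Nat.le_ceil _
    have h2 : ((⌈ν + m + l⌉₊ + 1 : ℕ) : ℝ) ≤ j := by exact_mod_cast hj
    push_cast at h2
    have : ν - j + l + m < 0 := by linarith
    exact this.ne)
  refine ⟨c, fun l => ∑ j ∈ Finset.range (J l), α j l, fun L => ?_⟩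
  -- This is the decay condition of `IsExpSymbol.hasPowerExpansion_integral` for regularity `ν - N`.
  obtain ⟨N₁, hN₁⟩ := exists_nat_gt (ν + 4 * L + |d - ν| + m)
  refine ⟨max (J L) N₁, fun N hN => ?_⟩
  have hN1 : (N₁ : ℝ) ≤ N := by exact_mod_cast (le_max_right _ _).trans hN
  obtain ⟨x, hx⟩ := (hr N).hasPowerExpansion_integral (s := d - ν) (by ring) L (by linarith)
  have hx' : HasLogExpansion (d - ν) 0 x L
      (fun μ => ∫ z, (a z μ - (χ z : ℂ) * ∑ j ∈ Finset.range N, A j z μ)) := by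
    unfold HasLogExpansion
    simpa using hx.trans (isBigO_rpow_log_mul_rpow le_rfl)
  refine ⟨_, (((HasLogExpansion.sum (fun j => hexp j L) N).add hx').congr' ?_).congr_coeff ?_
    fun _ _ => rfl⟩
  · filter_upwards [eventually_ge_atTop 0] with μ hμ
    have h1 : ∫ z, a z μ = (∑ j ∈ Finset.range N, ∫ z, (χ z : ℂ) * A j z μ) +
        ∫ z, (a z μ - (χ z : ℂ) * ∑ j ∈ Finset.range N, A j z μ) := by
      rw [← integral_finsetSum _ fun j _ => hAi j μ hμ,
        ← integral_add (integrable_finsetSum _ fun j _ => hAi j μ hμ) (hri N μ hμ)]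
      refine integral_congr_ae (Eventually.of_forall fun z => ?_)
      simp only [Finset.mul_sum]
      ring
    rw [h1, Finset.sum_sub_distrib]
    ring
  · intro l hl
    simp only [Pi.add_apply, Pi.zero_apply, add_zero]
    have hJl : J l ≤ N := by
      refine le_trans ?_ ((le_max_left _ _).trans hN)
      simp only [hJ]
      gcongr
    exact (Finset.sum_subset (Finset.range_mono hJl) fun j _ hj =>
      hα0 l j (by simpa using hj)).symm

end ParamSymbol

end

theorem mainTheorem2 (m : ℕ) (d ν : ℝ) (hd : d < -(m : ℝ))
    (a : ParamSymbol.E m → ℝ → ℂ) (ha : ParamSymbol.IsPolyhomSymbol d ν a) :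
    (∀ μ : ℝ, 0 ≤ μ → Integrable (fun z : ParamSymbol.E m => a z μ) volume) ∧
    ∃ c c' c'' : ℕ → ℂ, ∀ J L : ℕ,
      (fun μ : ℝ =>
        (∫ z : ParamSymbol.E m, a z μ)
          - ∑ j ∈ Finset.range J, c j * ((μ ^ (d + m - j) : ℝ) : ℂ)
          - ∑ l ∈ Finset.range L,
              (c' l * ((Real.log μ : ℝ) : ℂ) + c'' l) * ((μ ^ (d - ν - l) : ℝ) : ℂ))
        =O[atTop]
      (fun μ : ℝ => μ ^ (d + m - J) + (1 + Real.log μ) * μ ^ (d - ν - L)) := by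
  refine ⟨fun μ hμ => ha.1.1.integrable hd hμ, ?_⟩
  obtain ⟨c, c', h⟩ := ha.exists_truncated_expansion hd
  obtain ⟨c'', h⟩ := ParamSymbol.exists_common_coefficients h
  refine ⟨c, c', c'', fun J L => ?_⟩
  obtain ⟨N₀, hN₀⟩ := h L
  -- The expansion is taken with enough powers for order `L`; those with index at least `J` are then
  -- moved into the error.
  have hJN : J ≤ max N₀ J := le_max_right _ _
  have h1 := ParamSymbol.isBigO_sum_Ico_rpow c (d + m) J (max N₀ J)
  have h2 := hN₀ (max N₀ J) (le_max_left _ _)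
  have hle : ∀ᶠ μ : ℝ in atTop, 0 ≤ μ ^ (d + m - J) ∧ 0 ≤ (1 + Real.log μ) * μ ^ (d - ν - L) := by
    filter_upwards [eventually_ge_atTop 1] with μ hμ
    have := Real.log_nonneg hμ
    constructor <;> positivity
  have h3 : (fun μ : ℝ => μ ^ (d + m - J)) =O[atTop]
      fun μ : ℝ => μ ^ (d + m - J) + (1 + Real.log μ) * μ ^ (d - ν - L) := by
    refine IsBigO.of_bound 1 ?_
    filter_upwards [hle] with μ ⟨hμ1, hμ2⟩
    rw [Real.norm_of_nonneg hμ1, Real.norm_of_nonneg (add_nonneg hμ1 hμ2)]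
    linarith
  have h4 : (fun μ : ℝ => (1 + Real.log μ) * μ ^ (d - ν - L)) =O[atTop]
      fun μ : ℝ => μ ^ (d + m - J) + (1 + Real.log μ) * μ ^ (d - ν - L) := by
    refine IsBigO.of_bound 1 ?_
    filter_upwards [hle] with μ ⟨hμ1, hμ2⟩
    rw [Real.norm_of_nonneg hμ2, Real.norm_of_nonneg (add_nonneg hμ1 hμ2)]
    linarith
  refine ((h1.trans h3).add (IsBigO.trans h2 h4)).congr_left fun μ => ?_
  simp only
  rw [← Finset.sum_range_add_sum_Ico _ hJN]
  ring
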